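/- Let $R$ be a Noetherian integrally closed domain with field of fractions $K$, let $m\ge 0$, $A=R[x_0^{\pm1},\dots,x_m^{\pm1}]$ and $B=R[y_1^{\pm1},\dots,y_m^{\pm1}]$, with fields of fractions $K(\mathbf x)$ and $K(\mathbf y)$. Let $H$ be an $A$-algebra which is free and finitely generated as an $A$-module, with a symmetrizing form $t:H\to A$ (an $A$-linear form with $t(ab)=t(ba)$ such that $a\mapsto(h\mapsto t(ah))$ is an isomorphism $H\to\mathrm{Hom}_A(H,A)$), and such that $K(\mathbf x)H:=K(\mathbf x)\otimes_A H$ is split semisimple. For $\chi\in\mathrm{Irr}(K(\mathbf x)H)$ let $\chi^\vee\in K(\mathbf x)H$ be the element with $t(\chi^\vee h)=\chi(h)$ for all $h$, and let the Schur element $s_\chi\in K(\mathbf x)$ be the scalar by which the central element $\chi^\vee$ acts on a simple module with character $\chi$. Assume that $H$ is essential, that is, for every $\chi\in\mathrm{Irr}(K(\mathbf x)H)$, $$s_\chi=\xi_\chi N_\chi\prod_{i\in I_\chi}\Psi_{\chi,i}(M_{\chi,i})^{n_{\chi,i}},$$ where $\xi_\chi\in R$, $N_\chi$ is a monomial of degree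 $0$ in $A$, $I_\chi$ is a finite set, each $\Psi_{\chi,i}\in R[x]$ is monic of degree at least $1$, irreducible over $K$, prime to $x$ and to $x-1$ in $K[x]$ and with constant term a unit of $R$, each $M_{\chi,i}$ is a monomial of degree $0$ in $A$ whose exponents have gcd $1$, and the $n_{\chi,i}$ are positive integers. (A monomial is a product $\prod_j x_j^{c_j}$ with $c_j\in\mathbb Z$; its degree is $\sum_j c_j$.) Let $M=\prod_{i=0}^m x_i^{a_i}$ with $a=(a_0,\dots,a_m)\in\mathbb Z^{m+1}$ and $\gcd(a_i)=1$, and let $\varphi_M:A\to B$ be an $R$-algebra morphism associated with $M$, i.e. the morphism induced, on exponents of monomials, by a surjective homomorphism $\mathbb Z^{m+1}\to\mathbb Z^m$ with kernel $\mathbb Za$. Let $H_{\varphi_M}=B\otimes_A H$, with $B$ viewed as an $A$-algebra through $\varphi_M$. Let $\mathfrak p$ be a prime ideal of $R$ and $\mathfrak q_M=\mathfrak pA+(M-1)A$. Then $K(\mathbf y)H_{\varphi_M}$ is split semisimple, the ideals $\mathfrak q_M$ of $A$ and $\mathfrak pB$ of $B$ are prime, and $\varphi_M$ induces a bijection $\mathrm{Irr}(K(\mathbf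 x)H)\to\mathrm{Irr}(K(\mathbf y)H_{\varphi_M})$, $\chi\mapsto\chi_{\varphi_M}$, where $\chi(h)\in A$ and $\chi_{\varphi_M}(1\otimes h)=\varphi_M(\chi(h))$ for all $h\in H$. Under this bijection the blocks of $B_{\mathfrak pB}H_{\varphi_M}$ coincide with the blocks of $A_{\mathfrak q_M}H$: a subset $C$ of $\mathrm{Irr}(K(\mathbf x)H)$ is a block of $A_{\mathfrak q_M}H$ if and only if $\{\chi_{\varphi_M}:\chi\in C\}$ is a block of $B_{\mathfrak pB}H_{\varphi_M}$. Here a block of $A_{\mathfrak q_M}H$ is the set of characters of those simple $K(\mathbf x)H$-modules on which a given primitive idempotent of the centre of $A_{\mathfrak q_M}H$ acts as the identity, and similarly for $B_{\mathfrak pB}H_{\varphi_M}$. -/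

import Mathlib

open scoped TensorProduct

noncomputable section

namespace EssentialBlocks

universe u v w

/-! ### Characters of algebras over a field -/

section Characters

variable (F : Type u) [Field F] (S : Type v) [Ring S] [Algebra F S]

/-- `V` is a simple `S`-module whose character (the trace of the action) is the linear form `χ`. -/
def Affords (V : Type w) [AddCommGroup V] [Module F V] [Module S V] [IsScalarTower F S V]
    (χ : S →ₗ[F] F) : Prop :=
  IsSimpleModule S V ∧
    ∀ a : S, χ a = LinearMap.trace F V (Algebra.lsmul F F V a)

/-- The set `Irr(S)` of irreducible characters of the `F`-algebra `S`. (Every simple `S`-module is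
a quotient of `S`, so that it suffices to consider modules in the universe of `S`.) -/
def Irr : Type (max u v) :=
  {χ : S →ₗ[F] F // ∃ (V : Type v) (_ : AddCommGroup V) (_ : Module F V) (_ : Module S V)
    (_ : IsScalarTower F S V), Affords F S V χ}

/-- `S` is split: `End_S(V) = F` for every simple `S`-module `V`. -/
def IsSplit : Prop :=
  ∀ (V : Type v) [AddCommGroup V] [Module F V] [Module S V] [IsScalarTower F S V],
    IsSimpleModule S V → Function.Bijective (algebraMap F (Module.End S V))

/-- `S` is split semisimple. -/
def IsSplitSemisimple : Prop :=
  IsSemisimpleRing S ∧ IsSplit F S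

variable {F S}

/-- The element `z` of `S` acts as multiplication by the scalar `c` on a simple module with
character `χ`. For central `z` this says `ω_χ(z) = c`, with `ω_χ` the central character. -/
def ActsBy (χ : Irr F S) (z : S) (c : F) : Prop :=
  ∃ (V : Type v) (_ : AddCommGroup V) (_ : Module F V) (_ : Module S V)
    (_ : IsScalarTower F S V), Affords F S V χ.1 ∧ ∀ x : V, z • x = c • x

end Characters

/-! ### Symmetric algebras and Schur elements -/

section Symmetric

variable {O : Type u} [CommRing O] {S : Type v} [Ring S] [Algebra O S]

/-- The linear form `t` is symmetrizing: it is a trace function and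
`a ↦ (x ↦ t (a x))` is a bijection from `S` onto its dual. -/
def IsSymmetrizing (t : S →ₗ[O] O) : Prop :=
  (∀ a b : S, t (a * b) = t (b * a)) ∧
    Function.Bijective (fun a : S => t ∘ₗ LinearMap.mulLeft O a)

variable (F : Type w) [Field F] [Algebra O F]

/-- The extension of a linear form on `S` to `F ⊗ S`. -/
def extendForm (t : S →ₗ[O] O) : F ⊗[O] S →ₗ[F] F :=
  (TensorProduct.AlgebraTensorModule.rid O F F).toLinearMap ∘ₗ t.baseChange F

variable {F}

/-- `s` is the Schur element `ω_χ(χ^∨)` of `χ` with respect to `t`; here `χ^∨` is the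
element `z` of `F ⊗ S` that satisfies `t (z a) = χ a` for all `a`. -/
def IsSchurElement (t : S →ₗ[O] O) (χ : Irr F (F ⊗[O] S)) (s : F) : Prop :=
  ∃ z : F ⊗[O] S, (∀ a, extendForm F t (z * a) = χ.1 a) ∧ ActsBy χ z s

end Symmetric

/-! ### Blocks -/

/-- Block-idempotents: the primitive idempotents of the centre. -/
structure IsBlockIdempotent {S : Type v} [Ring S] (e : S) : Prop where
  idem : IsIdempotentElem e
  central : e ∈ Set.center S
  ne_zero : e ≠ 0
  primitive : ∀ f g : S, f ∈ Set.center S → g ∈ Set.center S → IsIdempotentElem f →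
    IsIdempotentElem g → f * g = 0 → e = f + g → f = 0 ∨ g = 0

section Blocks

variable (O : Type u) [CommRing O] [IsDomain O]

/-- The algebra `F S = F ⊗_O S` over the field of fractions `F` of `O`. -/
abbrev FracAlgebra (S : Type v) [Ring S] [Algebra O S] : Type (max u v) := FractionRing O ⊗[O] S

/-- The inclusion of the localization `O_P` in the field of fractions of `O`. -/
def locToFrac (P : Ideal O) [P.IsPrime] : Localization.AtPrime P →ₐ[O] FractionRing O :=
  IsLocalization.liftAlgHom (M := P.primeCompl) (f := Algebra.ofId O (FractionRing O))
    (fun y => IsLocalization.map_units (FractionRing O)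
      (⟨y.1, Ideal.primeCompl_le_nonZeroDivisors P y.2⟩ : nonZeroDivisors O))

variable (S : Type v) [Ring S] [Algebra O S]

/-- The blocks of `O_P S`, as subsets of `Irr(F S)` where `F` is the field of fractions of `O`:
the subset that belongs to a block-idempotent `e` of `O_P S` consists of the characters of the
simple modules on which `e` acts as the identity. -/
def blocksAt (P : Ideal O) [P.IsPrime] :
    Set (Set (Irr (FractionRing O) (FracAlgebra O S))) :=
  {C | ∃ e : Localization.AtPrime P ⊗[O] S, IsBlockIdempotent e ∧
    C = {χ | ActsBy χ (Algebra.TensorProduct.map (locToFrac O P) (AlgHom.id O S) e) 1}}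

end Blocks

/-! ### Specialization of an algebra along a ring morphism -/

section Specialization

variable {O : Type u} [CommRing O] {O' : Type w} [CommRing O'] (φ : O →+* O')
  (S : Type v) [Ring S] [Algebra O S]

/-- The specialization `S_φ = O' ⊗_O S`, where `O'` is an `O`-algebra through `φ`. -/
def Specialized : Type (max v w) :=
  letI := φ.toAlgebra
  O' ⊗[O] S

instance : Ring (Specialized φ S) :=
  @Algebra.TensorProduct.instRing O O' S _ _ φ.toAlgebra _ _

instance : Algebra O' (Specialized φ S) :=
  letI := φ.toAlgebra
  @Algebra.TensorProduct.leftAlgebra O O' O' S _ _ _ _ _ _ _ _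

variable {S}

/-- The canonical map `S → S_φ`, `h ↦ 1 ⊗ h`. -/
def specialize (h : S) : Specialized φ S :=
  letI := φ.toAlgebra
  (1 : O') ⊗ₜ[O] h

variable (S)

/-- `σ` is the bijection induced by `φ` between the irreducible characters of `S` over the field
of fractions of `O` and those of `S_φ` over the field of fractions of `O'`: each `χ` takes on `S`
values in `O`, and the values of `σ χ` on `S` are their images under `φ`. -/
def IsTitsBijection [IsDomain O] [IsDomain O']
    (σ : Irr (FractionRing O) (FracAlgebra O S) ≃
      Irr (FractionRing O') (FracAlgebra O' (Specialized φ S))) : Prop :=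
  ∀ χ (h : S), ∃ c : O,
    χ.1 (1 ⊗ₜ[O] h) = algebraMap O (FractionRing O) c ∧
    (σ χ).1 (1 ⊗ₜ[O'] specialize φ h) = algebraMap O' (FractionRing O') (φ c)

end Specialization

/-! ### Laurent polynomials, monomials, essential algebras -/

/-- The ring of Laurent polynomials in `n` indeterminates over `R`. -/
abbrev Laurent (R : Type u) [CommRing R] (n : ℕ) : Type u := AddMonoidAlgebra R (Fin n → ℤ)

section Laurent

variable (R : Type u) [CommRing R]

/-- The monomial `∏ i, x_i ^ a_i`. -/
def monomial {n : ℕ} (a : Fin n → ℤ) : Laurent R n := AddMonoidAlgebra.single a 1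

/-- The ideal `𝔭A + (M - 1)A`, where `M` is the monomial with exponents `a`. -/
def idealQ {n : ℕ} (p : Ideal R) (a : Fin n → ℤ) : Ideal (Laurent R n) :=
  p.map (algebraMap R (Laurent R n)) ⊔ Ideal.span {monomial R a - 1}

variable {R}

/-- `φ` is associated with the monomial with exponents `a`: it is induced by a surjective group
morphism `ℤ^(m+1) → ℤ^m` (on exponents) with kernel `ℤ a`. -/
def IsAssociatedWith {m : ℕ} (a : Fin (m + 1) → ℤ) (φ : Laurent R (m + 1) →ₐ[R] Laurent R m) :
    Prop :=
  ∃ f : (Fin (m + 1) → ℤ) →+ (Fin m → ℤ), Function.Surjective f ∧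
    f.ker = AddSubgroup.zmultiples a ∧ ∀ l, φ (monomial R l) = monomial R (f l)

/-- The algebra `H`, with the symmetrizing form `t`, is essential. -/
def IsEssential [IsDomain R] {n : ℕ} {H : Type v} [Ring H] [Algebra (Laurent R n) H]
    (t : H →ₗ[Laurent R n] Laurent R n) : Prop :=
  ∀ χ : Irr (FractionRing (Laurent R n)) (FracAlgebra (Laurent R n) H),
    ∃ (ξ : R) (N : Fin n → ℤ) (k : ℕ) (Ψ : Fin k → Polynomial R) (M : Fin k → Fin n → ℤ)
      (r : Fin k → ℕ),
      ∑ j, N j = 0 ∧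
      (∀ i, (Ψ i).Monic ∧ 1 ≤ (Ψ i).natDegree ∧
        Irreducible ((Ψ i).map (algebraMap R (FractionRing R))) ∧
        IsCoprime ((Ψ i).map (algebraMap R (FractionRing R))) Polynomial.X ∧
        IsCoprime ((Ψ i).map (algebraMap R (FractionRing R))) (Polynomial.X - 1) ∧
        IsUnit ((Ψ i).coeff 0)) ∧
      (∀ i, ∑ j, M i j = 0 ∧ Finset.univ.gcd (M i) = 1) ∧
      (∀ i, 0 < r i) ∧
      IsSchurElement t χ (algebraMap (Laurent R n) (FractionRing (Laurent R n))
        (algebraMap R (Laurent R n) ξ * monomial R N *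
          ∏ i, (Polynomial.aeval (monomial R (M i)) (Ψ i)) ^ r i))

end Laurent

end EssentialBlocks

end

open EssentialBlocks

/-!
For `φ` associated with the monomial `M`, the kernel of `φ` is generated by the prime `M - 1`, and
every nonzero Laurent polynomial has finite multiplicity at `M - 1`; so the localization `O` of `A`
at `ker φ` is a principal ideal domain, and its residue field is the field of fractions `L` of `B`.

Over a principal ideal domain the irreducible representations of `K(𝐱)H` can be realized by matrices
with entries in `O`. The Schur elements are units of `O`, and the inversion formula for a
symmetrizing form then shows that `O ⊗ H → ∏ Mat(O)` is surjective. Reducing it modulo the maximal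
ideal identifies `L ⊗ H_φ` with `∏ Mat(L)`, which gives the bijection of characters; it is
compatible with `φ` because characters of `H` have values in `A`, which is integrally closed.

On either side, a set `C` of characters is a union of blocks when the family with component `1` on
`C` and `0` elsewhere has a multiple in the image of the algebra by a scalar `d` outside the prime
ideal. Applying `φ` to such a multiple on the `A`-side gives one on the `B`-side. Conversely, lift a
multiple on the `B`-side to an element `h` of `H`. The characteristic polynomials of `h` have
coefficients in `A`, and under `φ` they become powers of `X - d` on `C` and of `X` elsewhere. By
Cayley–Hamilton, suitable products of them evaluated at `h` produce a multiple on the `A`-side.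
-/

open scoped TensorProduct Matrix

noncomputable section

namespace EssentialBlocks

universe u v w

/-! ### Products of matrix algebras -/

section ComponentIdem

variable {ι : Type*} (M : ι → Type*) [∀ i, Ring (M i)]

open Classical in
/-- The central idempotent of a product of rings that cuts out the components in `C`. -/
def componentIdem (C : Set ι) : Π i, M i := C.piecewise 1 0

variable {M} {C : Set ι} {i : ι}

lemma componentIdem_of_mem (hi : i ∈ C) : componentIdem M C i = 1 := by
  classical exact Set.piecewise_eq_of_mem _ _ _ hi

lemma componentIdem_of_notMem (hi : i ∉ C) : componentIdem M C i = 0 := by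
  classical exact Set.piecewise_eq_of_notMem _ _ _ hi

lemma eq_smul_componentIdem_iff {A : Type*} [Semiring A] [∀ i, Module A (M i)] {c : A}
    {T : Π i, M i} :
    T = c • componentIdem M C ↔ (∀ i ∈ C, T i = c • 1) ∧ ∀ i ∉ C, T i = 0 := by
  constructor
  · rintro rfl
    exact ⟨fun i hi => by rw [Pi.smul_apply, componentIdem_of_mem hi],
      fun i hi => by rw [Pi.smul_apply, componentIdem_of_notMem hi, smul_zero]⟩
  · rintro ⟨hmem, hnotMem⟩
    funext i
    by_cases hi : i ∈ C
    · rw [hmem i hi, Pi.smul_apply, componentIdem_of_mem hi]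
    · rw [hnotMem i hi, Pi.smul_apply, componentIdem_of_notMem hi, smul_zero]

lemma componentIdem_empty : componentIdem M ∅ = 0 :=
  funext fun _ => componentIdem_of_notMem (Set.notMem_empty _)

lemma componentIdem_mul (C D : Set ι) :
    componentIdem M C * componentIdem M D = componentIdem M (C ∩ D) := by
  funext i
  by_cases hC : i ∈ C <;> by_cases hD : i ∈ D <;>
    simp [componentIdem_of_mem, componentIdem_of_notMem, hC, hD]

lemma componentIdem_sdiff {C D : Set ι} (hDC : D ⊆ C) :
    componentIdem M (C \ D) = componentIdem M C - componentIdem M D := by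
  funext i
  by_cases hC : i ∈ C <;> by_cases hD : i ∈ D
  · simp [componentIdem_of_mem, componentIdem_of_notMem, hC, hD]
  · simp [componentIdem_of_mem, componentIdem_of_notMem, hC, hD]
  · exact absurd (hDC hD) hC
  · simp [componentIdem_of_notMem, hC, hD]

lemma isIdempotentElem_componentIdem (C : Set ι) : IsIdempotentElem (componentIdem M C) :=
  (componentIdem_mul C C).trans (congrArg _ (Set.inter_self C))

lemma componentIdem_mem_center (C : Set ι) : componentIdem M C ∈ Set.center (Π i, M i) :=
  Semigroup.mem_center_iff.2 fun x => funext fun i => by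
    by_cases hi : i ∈ C
    · rw [Pi.mul_apply, Pi.mul_apply, componentIdem_of_mem hi, mul_one, one_mul]
    · rw [Pi.mul_apply, Pi.mul_apply, componentIdem_of_notMem hi, mul_zero, zero_mul]

variable (M) in
lemma componentIdem_injective [∀ i, Nontrivial (M i)] : Function.Injective (componentIdem M) := by
  have hmem (C : Set ι) (i : ι) : i ∈ C ↔ componentIdem M C i = 1 := by
    refine ⟨componentIdem_of_mem, fun h => ?_⟩
    by_contra hi
    exact zero_ne_one ((componentIdem_of_notMem hi).symm.trans h)
  intro C D h
  ext i
  rw [hmem, hmem, h]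

end ComponentIdem

section MatrixProd

/-- The product of the algebras of `n i × n i` matrices over `R`. -/
abbrev MatrixProd (R : Type*) {ι : Type*} (n : ι → ℕ) : Type _ :=
  Π i, Matrix (Fin (n i)) (Fin (n i)) R

variable {A R R' : Type*} [CommRing A] [CommRing R] [CommRing R'] [Algebra A R] [Algebra A R']
  {ι : Type*} {n : ι → ℕ}

/-- The morphism between products of matrix algebras that applies `g` to all entries. -/
def MatrixProd.map (g : R →ₐ[A] R') : MatrixProd R n →ₐ[A] MatrixProd R' n :=
  AlgHom.pi fun i => g.mapMatrix.comp (Pi.evalAlgHom A _ i)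

lemma MatrixProd.map_apply (g : R →ₐ[A] R') (T : MatrixProd R n) (i : ι) :
    MatrixProd.map g T i = (T i).map g := rfl

lemma MatrixProd.map_injective {g : R →ₐ[A] R'} (hg : Function.Injective g) :
    Function.Injective (MatrixProd.map (n := n) g) := fun _ _ h =>
  funext fun i => Matrix.map_injective hg (congrFun h i)

lemma MatrixProd.map_surjective {g : R →ₐ[A] R'} (hg : Function.Surjective g) :
    Function.Surjective (MatrixProd.map (n := n) g) := fun T =>
  ⟨fun i => (T i).map (Function.surjInv hg), funext fun _ => Matrix.ext fun _ _ =>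
    Function.surjInv_eq hg _⟩

lemma MatrixProd.map_componentIdem (g : R →ₐ[A] R') (C : Set ι) :
    MatrixProd.map (n := n) g (componentIdem _ C) = componentIdem _ C := by
  funext i
  by_cases hi : i ∈ C
  · rw [map_apply, componentIdem_of_mem hi, componentIdem_of_mem hi]
    exact map_one g.mapMatrix
  · rw [map_apply, componentIdem_of_notMem hi, componentIdem_of_notMem hi]
    exact map_zero g.mapMatrix

lemma exists_eq_componentIdem_of_mem_center [IsDomain R] {e : MatrixProd R n}
    (he : IsIdempotentElem e) (hc : e ∈ Set.center (MatrixProd R n)) :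
    ∃ C, e = componentIdem _ C := by
  suffices h : ∀ i, e i = 0 ∨ e i = 1 by
    refine ⟨{i | e i = 1}, funext fun i => ?_⟩
    by_cases hi : i ∈ {i | e i = 1}
    · rw [componentIdem_of_mem hi]
      exact hi
    · rw [componentIdem_of_notMem hi]
      exact (h i).resolve_right hi
  intro i
  have hci : e i ∈ Set.center (Matrix (Fin (n i)) (Fin (n i)) R) :=
    Set.center_pi.subset hc i trivial
  rw [Matrix.center_eq_scalar_image] at hci
  obtain ⟨c, -, hce⟩ := hci
  cases isEmpty_or_nonempty (Fin (n i))
  · exact Or.inl (Subsingleton.elim _ _)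
  · have hidem : IsIdempotentElem c := Matrix.scalar_inj (n := Fin (n i)).1 <| by
      rw [map_mul, hce]
      exact congrFun he i
    rcases IsIdempotentElem.iff_eq_zero_or_one.1 hidem with rfl | rfl
    · exact Or.inl (hce ▸ map_zero _)
    · exact Or.inr (hce ▸ map_one _)

end MatrixProd

/-! ### Irreducible characters of a product of matrix algebras -/

section Characters

variable {F : Type u} [Field F] {S : Type v} [Ring S] [Algebra F S] {χ : S →ₗ[F] F}
  {V : Type*} [AddCommGroup V] [Module F V] [Module S V] [IsScalarTower F S V]
  {V' : Type*} [AddCommGroup V'] [Module F V'] [Module S V'] [IsScalarTower F S V']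

lemma Affords.congr (h : Affords F S V χ) (e : V ≃ₗ[S] V') : Affords F S V' χ := by
  have := h.1
  refine ⟨IsSimpleModule.congr e.symm, fun a => ?_⟩
  rw [h.2, ← LinearMap.trace_conj' _ (e.restrictScalars F)]
  congr 1
  ext x
  simp [LinearEquiv.conj_apply]

lemma Affords.exists_quotient (h : Affords F S V χ) :
    ∃ I : Ideal S, Affords F S (S ⧸ I) χ ∧ Nonempty (V ≃ₗ[S] S ⧸ I) := by
  obtain ⟨I, -, ⟨e⟩⟩ := isSimpleModule_iff_quot_maximal.1 h.1
  exact ⟨I, h.congr e, ⟨e⟩⟩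

/-- The character afforded by a simple module that may live in any universe. -/
def Affords.irr (h : Affords F S V χ) : Irr F S :=
  ⟨χ, by
    obtain ⟨I, hI, -⟩ := h.exists_quotient
    exact ⟨S ⧸ I, inferInstance, inferInstance, inferInstance, inferInstance, hI⟩⟩

lemma Affords.actsBy {χ : Irr F S} (h : Affords F S V χ.1) {z : S} {c : F}
    (hz : ∀ x : V, z • x = c • x) : ActsBy χ z c := by
  obtain ⟨I, hI, ⟨e⟩⟩ := h.exists_quotient
  refine ⟨S ⧸ I, inferInstance, inferInstance, inferInstance, inferInstance, hI, fun x => ?_⟩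
  obtain ⟨y, rfl⟩ := e.surjective x
  rw [← e.map_smul, hz]
  exact (e.restrictScalars F).map_smul c y

end Characters

section ColumnModule

variable {F : Type u} [Field F] {S : Type v} [Ring S] [Algebra F S]
  {ι : Type*} {n : ι → ℕ} (Φ : S ≃ₐ[F] MatrixProd F n)

/-- The space of column vectors of size `n i`, on which `S` acts through the component `i` of
`Φ`. -/
def ColumnModule (_ : S ≃ₐ[F] MatrixProd F n) (i : ι) : Type u := Fin (n i) → F

namespace ColumnModule

variable (i : ι)

instance : AddCommGroup (ColumnModule Φ i) := inferInstanceAs (AddCommGroup (Fin (n i) → F))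

instance : Module F (ColumnModule Φ i) := inferInstanceAs (Module F (Fin (n i) → F))

instance : Module S (ColumnModule Φ i) :=
  letI : Module (Module.End F (Fin (n i) → F)) (ColumnModule Φ i) :=
    inferInstanceAs (Module (Module.End F (Fin (n i) → F)) (Fin (n i) → F))
  Module.compHom _ ((Matrix.toLinAlgEquiv'.toAlgHom.comp
    ((Pi.evalAlgHom F _ i).comp Φ.toAlgHom)).toRingHom : S →+* Module.End F (Fin (n i) → F))

variable {i}

/-- The coordinates of a column. -/
def coords : ColumnModule Φ i ≃ₗ[F] (Fin (n i) → F) := LinearEquiv.refl F _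

lemma coords_smul (a : S) (y : ColumnModule Φ i) :
    coords Φ (a • y) = Φ a i *ᵥ coords Φ y := rfl

instance : IsScalarTower F S (ColumnModule Φ i) :=
  ⟨fun c a y => (coords Φ).injective <| by
    rw [coords_smul, map_smul, map_smul, coords_smul, Pi.smul_apply, Matrix.smul_mulVec]⟩

lemma trace_lsmul (a : S) :
    LinearMap.trace F (ColumnModule Φ i) (Algebra.lsmul F F (ColumnModule Φ i) a) =
      (Φ a i).trace :=
  Matrix.trace_toLin'_eq (Φ a i)

end ColumnModule

/-- The character `a ↦ tr (Φ a i)` of `ColumnModule Φ i`. -/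
def traceForm (i : ι) : S →ₗ[F] F :=
  Matrix.traceLinearMap (Fin (n i)) F F ∘ₗ LinearMap.proj i ∘ₗ Φ.toLinearEquiv.toLinearMap

lemma traceForm_apply (i : ι) (a : S) : traceForm Φ i a = (Φ a i).trace := rfl

variable [DecidableEq ι]

/-- The element of `S` that corresponds to the matrix `E` in the component `i`. -/
def matrixSingle (i : ι) (E : Matrix (Fin (n i)) (Fin (n i)) F) : S := Φ.symm (Pi.single i E)

@[simp]
lemma apply_matrixSingle (i : ι) (E : Matrix (Fin (n i)) (Fin (n i)) F) :
    Φ (matrixSingle Φ i E) = Pi.single i E :=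
  Φ.apply_symm_apply _

lemma mul_matrixSingle (a : S) (i : ι) (E : Matrix (Fin (n i)) (Fin (n i)) F) :
    a * matrixSingle Φ i E = matrixSingle Φ i (Φ a i * E) :=
  Φ.injective <| by rw [map_mul, apply_matrixSingle, apply_matrixSingle, Pi.single_mul_right]

lemma sum_matrixSingle_diag [Fintype ι] :
    ∑ i, ∑ j, matrixSingle Φ i (Matrix.single j j 1) = 1 :=
  Φ.injective <| by
    have hsum (i : ι) : ∑ j, Pi.single i (Matrix.single j j (1 : F)) =
        (Pi.single i 1 : MatrixProd F n) := by
      rw [← Matrix.sum_single_one]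
      exact (map_sum (AddMonoidHom.single (fun i => Matrix (Fin (n i)) (Fin (n i)) F) i) _ _).symm
    simp only [map_sum, apply_matrixSingle, map_one, hsum]
    exact Finset.univ_sum_single 1

namespace ColumnModule

variable {Φ} {i : ι}

lemma matrixSingle_vecMulVec_smul (z : Fin (n i) → F) (j : Fin (n i)) (c : F)
    (y : ColumnModule Φ i) :
    matrixSingle Φ i (Matrix.vecMulVec z (Pi.single j c)) • y =
      (c * coords Φ y j) • (coords Φ).symm z :=
  (coords Φ).injective <| by
    rw [coords_smul, apply_matrixSingle, Pi.single_eq_same, Matrix.vecMulVec_mulVec,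
      single_dotProduct, map_smul, LinearEquiv.apply_symm_apply, op_smul_eq_smul]

variable (Φ) {V : Type*} [AddCommGroup V] [Module S V]

/-- The `S`-linear map from columns to `V` that sends `y` to `E • x`, where `E` is the matrix in
the component `i` whose column `j` is `y` and whose other columns vanish. -/
def homOfElement (j : Fin (n i)) (x : V) : ColumnModule Φ i →ₗ[S] V where
  toFun y := matrixSingle Φ i (Matrix.vecMulVec (coords Φ y) (Pi.single j 1)) • x
  map_add' y z := by
    simp only [map_add, Matrix.add_vecMulVec, matrixSingle, Pi.single_add, add_smul]
  map_smul' a y := by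
    rw [coords_smul, ← Matrix.mul_vecMulVec, ← mul_matrixSingle, mul_smul, RingHom.id_apply]

lemma homOfElement_single (j : Fin (n i)) (x : V) :
    homOfElement Φ j x ((coords Φ).symm (Pi.single j 1)) =
      matrixSingle Φ i (Matrix.single j j 1) • x := by
  rw [Matrix.single_eq_single_vecMulVec_single]
  rfl

end ColumnModule

end ColumnModule

section SplitSemisimple

variable {F : Type u} [Field F] {S : Type v} [Ring S] [Algebra F S]
  {ι : Type*} {n : ι → ℕ} {Φ : S ≃ₐ[F] MatrixProd F n} {i : ι}

namespace ColumnModule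

lemma exists_smul_eq {y : ColumnModule Φ i} (hy : y ≠ 0) (z : ColumnModule Φ i) :
    ∃ a : S, a • y = z := by
  classical
  obtain ⟨j, hj⟩ : ∃ j, coords Φ y j ≠ 0 := Function.ne_iff.1 hy
  refine ⟨matrixSingle Φ i (Matrix.vecMulVec (coords Φ z) (Pi.single j (coords Φ y j)⁻¹)), ?_⟩
  rw [matrixSingle_vecMulVec_smul, inv_mul_cancel₀ hj, one_smul, LinearEquiv.symm_apply_apply]

lemma exists_end_eq_smul (g : Module.End S (ColumnModule Φ i)) : ∃ c : F, ∀ y, g y = c • y := by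
  classical
  cases isEmpty_or_nonempty (Fin (n i))
  · exact ⟨0, fun y => (coords Φ).injective (Subsingleton.elim _ _)⟩
  · let j := Classical.arbitrary (Fin (n i))
    let u : ColumnModule Φ i := (coords Φ).symm (Pi.single j 1)
    refine ⟨coords Φ (g u) j, fun y => ?_⟩
    have hy : y = matrixSingle Φ i (Matrix.vecMulVec (coords Φ y) (Pi.single j 1)) • u := by
      simp [matrixSingle_vecMulVec_smul, u]
    conv_lhs => rw [hy]
    rw [map_smul, matrixSingle_vecMulVec_smul, one_mul, LinearEquiv.symm_apply_apply]

variable (Φ)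

lemma isSimpleModule (i : ι) [NeZero (n i)] : IsSimpleModule S (ColumnModule Φ i) :=
  isSimpleModule_iff_toSpanSingleton_surjective.2
    ⟨inferInstanceAs (Nontrivial (Fin (n i) → F)), fun _ hy => exists_smul_eq hy⟩

lemma affords (i : ι) [NeZero (n i)] : Affords F S (ColumnModule Φ i) (traceForm Φ i) :=
  ⟨isSimpleModule Φ i, fun a => (trace_lsmul Φ a).symm⟩

lemma exists_linearEquiv [Finite ι] (V : Type*) [AddCommGroup V] [Module S V]
    [IsSimpleModule S V] :
    ∃ i, NeZero (n i) ∧ Nonempty (ColumnModule Φ i ≃ₗ[S] V) := by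
  classical
  have := Fintype.ofFinite ι
  have := IsSimpleModule.nontrivial S V
  obtain ⟨x, hx⟩ := exists_ne (0 : V)
  obtain ⟨i, j, hij⟩ : ∃ i j, matrixSingle Φ i (Matrix.single j j 1) • x ≠ 0 := by
    by_contra! h
    apply hx
    rw [← one_smul S x, ← sum_matrixSingle_diag Φ]
    simp only [Finset.sum_smul, h, Finset.sum_const_zero]
  have hi : NeZero (n i) := ⟨(Fin.pos j).ne'⟩
  have := isSimpleModule Φ i
  have hne : homOfElement Φ j x ≠ 0 := fun h => hij <| by
    rw [← homOfElement_single, h, LinearMap.zero_apply]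
  exact ⟨i, hi, ⟨.ofBijective _ ((homOfElement Φ j x).bijective_or_eq_zero.resolve_right hne)⟩⟩

end ColumnModule

lemma isSplitSemisimple_of_algEquiv {F : Type u} [Field F] {S : Type v} [Ring S] [Algebra F S]
    {ι : Type*} [Finite ι] {n : ι → ℕ} (Φ : S ≃ₐ[F] MatrixProd F n) : IsSplitSemisimple F S := by
  refine ⟨Φ.symm.toRingEquiv.isSemisimpleRing, fun V _ _ _ _ hV => ?_⟩
  have := IsSimpleModule.nontrivial S V
  refine ⟨FaithfulSMul.algebraMap_injective F (Module.End S V), fun g => ?_⟩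
  obtain ⟨i, -, ⟨e⟩⟩ := ColumnModule.exists_linearEquiv Φ V
  obtain ⟨c, hc⟩ := ColumnModule.exists_end_eq_smul (e.symm.toLinearMap ∘ₗ g ∘ₗ e.toLinearMap)
  refine ⟨c, LinearMap.ext fun x => e.symm.injective ?_⟩
  have hx := hc (e.symm x)
  simp only [LinearMap.comp_apply, LinearEquiv.coe_coe, e.apply_symm_apply] at hx
  rw [hx, Module.algebraMap_end_apply]
  exact (e.symm.restrictScalars F).map_smul c x

variable (Φ) [∀ i, NeZero (n i)]

lemma traceForm_injective : Function.Injective (traceForm Φ) := by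
  intro i j hij
  classical
  by_contra hne
  have h := LinearMap.congr_fun hij (matrixSingle Φ i (Matrix.single 0 0 1))
  rw [traceForm_apply, traceForm_apply, apply_matrixSingle, Pi.single_eq_same,
    Pi.single_eq_of_ne (Ne.symm hne), Matrix.trace_single_eq_same, Matrix.trace_zero] at h
  exact one_ne_zero h

/-- The irreducible characters of a product of matrix algebras are indexed by the components. -/
def irrEquiv [Finite ι] : ι ≃ Irr F S :=
  Equiv.ofBijective (fun i => (ColumnModule.affords Φ i).irr)
    ⟨fun _ _ h => traceForm_injective Φ (congrArg Subtype.val h), by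
      rintro ⟨χ, V, _, _, _, _, hV⟩
      have := hV.1
      obtain ⟨i, -, ⟨e⟩⟩ := ColumnModule.exists_linearEquiv Φ V
      refine ⟨i, Subtype.ext (LinearMap.ext fun a => ?_)⟩
      exact (((ColumnModule.affords Φ i).congr e).2 a).trans (hV.2 a).symm⟩

lemma irrEquiv_apply [Finite ι] (i : ι) (a : S) : (irrEquiv Φ i).1 a = (Φ a i).trace := rfl

lemma actsBy_irrEquiv_iff [Finite ι] (i : ι) (z : S) (c : F) :
    ActsBy (irrEquiv Φ i) z c ↔ Φ z i = c • 1 := by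
  have hcolumns : (∀ x : ColumnModule Φ i, z • x = c • x) ↔ Φ z i = c • 1 := by
    refine ⟨fun h => Matrix.mulVec_injective (funext fun y => ?_), fun h x => ?_⟩
    · rw [Matrix.smul_mulVec, Matrix.one_mulVec]
      exact h ((ColumnModule.coords Φ).symm y)
    · apply (ColumnModule.coords Φ).injective
      rw [ColumnModule.coords_smul, h, Matrix.smul_mulVec, Matrix.one_mulVec, map_smul]
  rw [← hcolumns]
  refine ⟨?_, (ColumnModule.affords Φ i).actsBy⟩
  rintro ⟨V, _, _, _, _, hV, hz⟩ x
  have := hV.1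
  obtain ⟨j, -, ⟨e⟩⟩ := ColumnModule.exists_linearEquiv Φ V
  obtain rfl : i = j := traceForm_injective Φ <| LinearMap.ext fun a =>
    (hV.2 a).trans (((ColumnModule.affords Φ j).congr e).2 a).symm
  apply e.injective
  rw [e.map_smul, hz]
  exact ((e.restrictScalars F).map_smul c x).symm

end SplitSemisimple

lemma exists_algEquiv_of_isSplitSemisimple {F : Type u} [Field F] {S : Type v} [Ring S]
    [Algebra F S] (h : IsSplitSemisimple F S) :
    ∃ (k : ℕ) (n : Fin k → ℕ), (∀ i, NeZero (n i)) ∧ Nonempty (S ≃ₐ[F] MatrixProd F n) := by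
  obtain ⟨hss, hsplit⟩ := h
  obtain ⟨k, I, n, hI, hn, ⟨e⟩⟩ := IsSemisimpleRing.exists_algEquiv_pi_matrix_end_mulOpposite F S
  have hend (i : Fin k) :
      Function.Bijective (Algebra.ofId F (Module.End S (I i))ᵐᵒᵖ) :=
    MulOpposite.opEquiv.bijective.comp (hsplit (I i) (hI i))
  exact ⟨k, n, hn, ⟨e.trans (AlgEquiv.piCongrRight fun i =>
    (AlgEquiv.ofBijective _ (hend i)).symm.mapMatrix)⟩⟩

/-! ### Extension of scalars to a localization -/

lemma exists_smul_eq_one_tmul {A : Type*} [CommRing A] (W : Submonoid A) (A' : Type*) [CommRing A']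
    [Algebra A A'] [IsLocalization W A'] {H : Type*} [AddCommGroup H] [Module A H]
    (z : A' ⊗[A] H) : ∃ d ∈ W, ∃ h : H, d • z = 1 ⊗ₜ[A] h := by
  obtain ⟨⟨h, d⟩, hd⟩ := IsLocalizedModule.surj W (TensorProduct.mk A A' H 1) z
  exact ⟨d, d.2, h, hd⟩

section Form

variable {A : Type*} [CommRing A] {F : Type*} [Field F] [Algebra A F]
  {H : Type*} [Ring H] [Algebra A H] {t : H →ₗ[A] A}

lemma extendForm_one_tmul (h : H) : extendForm F t (1 ⊗ₜ[A] h) = algebraMap A F (t h) := by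
  simp [extendForm, Algebra.algebraMap_eq_smul_one]

lemma eq_zero_of_extendForm_mul_eq_zero [IsFractionRing A F] (ht : IsSymmetrizing t)
    {z : F ⊗[A] H} (hz : ∀ h : H, extendForm F t (z * 1 ⊗ₜ[A] h) = 0) : z = 0 := by
  obtain ⟨d, hd, h, hdh⟩ := exists_smul_eq_one_tmul (nonZeroDivisors A) F z
  have hd0 : algebraMap A F d ≠ 0 :=
    (IsLocalization.map_units F (⟨d, hd⟩ : nonZeroDivisors A)).ne_zero
  rw [← algebraMap_smul F] at hdh
  have hh : h = 0 := by
    refine ht.2.1 (LinearMap.ext fun x => IsFractionRing.injective A F ?_)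
    have hdx : extendForm F t (algebraMap A F d • z * 1 ⊗ₜ[A] x) = 0 := by
      rw [smul_mul_assoc, map_smul, hz, smul_zero]
    rw [hdh, Algebra.TensorProduct.tmul_mul_tmul, one_mul, extendForm_one_tmul] at hdx
    simpa using hdx
  rw [hh, TensorProduct.tmul_zero] at hdh
  exact (smul_eq_zero.1 hdh).resolve_left hd0

end Form

/-! ### Integral models -/

section OrbitSpan

variable {A O F : Type*} [CommRing A] [CommRing O] [Field F] [Algebra O F] [Algebra A F]
  {H : Type*} [Ring H] [Algebra A H]
  {V : Type*} [AddCommGroup V] [Module F V] [Module O V]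

variable (O) in
/-- The `O`-submodule generated by the orbit of `y` under a representation of `H` over `F`. For an
irreducible representation it is a lattice that is stable under `H`. -/
def orbitSpan (f : F ⊗[A] H →ₐ[F] Module.End F V) (y : V) : Submodule O V :=
  Submodule.span O (Set.range fun h : H => f (1 ⊗ₜ[A] h) y)

variable {f : F ⊗[A] H →ₐ[F] Module.End F V} {y : V}

lemma apply_mem_orbitSpan [IsScalarTower O F V] (h : H) {x : V} (hx : x ∈ orbitSpan O f y) :
    f (1 ⊗ₜ[A] h) x ∈ orbitSpan O f y := by
  suffices orbitSpan O f y ≤ (orbitSpan O f y).comap ((f (1 ⊗ₜ[A] h)).restrictScalars O) from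
    this hx
  refine Submodule.span_le.2 ?_
  rintro _ ⟨h', rfl⟩
  refine Submodule.subset_span ⟨h * h', ?_⟩
  simp only [LinearMap.coe_restrictScalars]
  rw [← Module.End.mul_apply, ← map_mul, Algebra.TensorProduct.tmul_mul_tmul, one_mul]

lemma fg_orbitSpan [Algebra A O] [IsScalarTower A O F] [IsScalarTower O F V] [Module.Finite A H] :
    (orbitSpan O f y).FG := by
  let := Module.compHom V (algebraMap A F)
  have : IsScalarTower A F V := .of_algebraMap_smul fun _ _ => rfl
  have : IsScalarTower A O V := .of_algebraMap_smul fun a x => by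
    rw [← algebraMap_smul F, ← IsScalarTower.algebraMap_apply, algebraMap_smul]
  let g : H →ₗ[A] V := (LinearMap.applyₗ y).restrictScalars A ∘ₗ
    f.toLinearMap.restrictScalars A ∘ₗ TensorProduct.mk A F H 1
  obtain ⟨s, hs⟩ := Module.Finite.fg_top (R := A) (M := H)
  have hspan : orbitSpan O f y = Submodule.span O (g '' s) := by
    rw [← Submodule.span_span_of_tower A O (g '' s), ← Submodule.map_span, hs, Submodule.map_top]
    rfl
  exact hspan ▸ Submodule.fg_span (s.finite_toSet.image g)

lemma span_orbitSpan [IsScalarTower O F V] (hy : ∀ x, ∃ z, f z y = x) :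
    Submodule.span F (orbitSpan O f y : Set V) = ⊤ := by
  rw [orbitSpan, Submodule.span_span_of_tower, eq_top_iff]
  rintro x -
  obtain ⟨z, rfl⟩ := hy x
  induction z using TensorProduct.induction_on with
  | zero => simp
  | add z z' hz hz' => simpa using Submodule.add_mem _ hz hz'
  | tmul c h =>
    rw [← mul_one c, ← smul_eq_mul, ← TensorProduct.smul_tmul', map_smul]
    exact Submodule.smul_mem _ c (Submodule.subset_span ⟨h, rfl⟩)

end OrbitSpan

lemma toMatrixAlgEquiv_extendOfIsLattice_mem_range {O F V κ : Type*} [CommRing O] [Field F]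
    [Algebra O F] [IsFractionRing O F] [AddCommGroup V] [Module F V] [Module O V]
    [IsScalarTower O F V] [Fintype κ] [DecidableEq κ] {Λ : Submodule O V} [Λ.IsLattice F]
    (b : Module.Basis κ O Λ) {g : Module.End F V} (hg : ∀ x ∈ Λ, g x ∈ Λ) (i j : κ) :
    LinearMap.toMatrixAlgEquiv (b.extendOfIsLattice F) g i j ∈ Set.range (algebraMap O F) := by
  let x : Λ := ⟨g (b j), hg _ (b j).2⟩
  have hx : g (b.extendOfIsLattice F j) =
      ∑ i, algebraMap O F (b.repr x i) • b.extendOfIsLattice F i := by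
    have := congrArg Subtype.val (b.sum_repr x)
    rw [Submodule.coe_sum] at this
    simp only [Module.Basis.extendOfIsLattice_apply, algebraMap_smul]
    exact this.symm
  refine ⟨b.repr x i, ?_⟩
  rw [LinearMap.toMatrixAlgEquiv_apply, hx, Module.Basis.repr_sum_self]

lemma exists_algHom_comp_eq {A B C H : Type*} [CommSemiring A] [Semiring B] [Semiring C]
    [Semiring H] [Algebra A B] [Algebra A C] [Algebra A H] {g : B →ₐ[A] C}
    (hg : Function.Injective g) {f : H →ₐ[A] C} (hf : ∀ h, f h ∈ g.range) :
    ∃ ρ : H →ₐ[A] B, g.comp ρ = f :=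
  ⟨(AlgEquiv.ofInjective g hg).symm.toAlgHom.comp (f.codRestrict g.range hf), AlgHom.ext fun h =>
    congrArg Subtype.val ((AlgEquiv.ofInjective g hg).apply_symm_apply (f.codRestrict _ hf h))⟩

section Model

variable {A O F : Type*} [CommRing A] [CommRing O] [IsDomain O] [IsPrincipalIdealRing O] [Field F]
  [Algebra A O] [Algebra O F] [Algebra A F] [IsScalarTower A O F] [IsFractionRing O F]
  {H : Type*} [Ring H] [Algebra A H] [Module.Finite A H]

variable (O) in
lemma exists_basis_toMatrix_mem_range {k : ℕ} {f : F ⊗[A] H →ₐ[F] Module.End F (Fin k → F)}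
    {y : Fin k → F} (hy : ∀ x, ∃ z, f z y = x) :
    ∃ b : Module.Basis (Fin k) F (Fin k → F), ∀ (h : H) i j,
      LinearMap.toMatrixAlgEquiv b (f (1 ⊗ₜ[A] h)) i j ∈ Set.range (algebraMap O F) := by
  have : (orbitSpan O f y).IsLattice F := ⟨fg_orbitSpan, span_orbitSpan hy⟩
  let b : Module.Basis (Fin k) O (orbitSpan O f y) := Module.finBasisOfFinrankEq O _ <| by
    rw [Submodule.IsLattice.finrank_of_pi F, Fintype.card_fin]
  exact ⟨b.extendOfIsLattice F, fun h =>
    toMatrixAlgEquiv_extendOfIsLattice_mem_range b fun _ => apply_mem_orbitSpan h⟩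

variable (O) in
lemma exists_integral_model {ι : Type*} {n : ι → ℕ} [∀ i, NeZero (n i)]
    (Φ₀ : F ⊗[A] H ≃ₐ[F] MatrixProd F n) :
    ∃ (Φ : F ⊗[A] H ≃ₐ[F] MatrixProd F n) (ρ : H →ₐ[A] MatrixProd O n),
      ∀ h, Φ (1 ⊗ₜ[A] h) = MatrixProd.map (IsScalarTower.toAlgHom A O F) (ρ h) := by
  classical
  let f (i : ι) : F ⊗[A] H →ₐ[F] Module.End F (Fin (n i) → F) :=
    Matrix.toLinAlgEquiv'.toAlgHom.comp ((Pi.evalAlgHom F _ i).comp Φ₀.toAlgHom)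
  have hf (i : ι) (x : Fin (n i) → F) : ∃ z, f i z (Pi.single 0 1) = x :=
    ColumnModule.exists_smul_eq (Φ := Φ₀) (i := i) (Pi.single_ne_zero_iff.2 one_ne_zero) x
  choose b hb using fun i => exists_basis_toMatrix_mem_range O (hf i)
  let Φ : F ⊗[A] H ≃ₐ[F] MatrixProd F n := Φ₀.trans <| AlgEquiv.piCongrRight fun i =>
    Matrix.toLinAlgEquiv'.trans (LinearMap.toMatrixAlgEquiv (b i))
  have hΦ (h : H) : Φ (1 ⊗ₜ[A] h) ∈
      (MatrixProd.map (n := n) (IsScalarTower.toAlgHom A O F)).range := by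
    choose T hT using fun i => hb i h
    exact ⟨fun i => Matrix.of (T i), funext fun i => Matrix.ext (hT i)⟩
  obtain ⟨ρ, hρ⟩ := exists_algHom_comp_eq (MatrixProd.map_injective (IsFractionRing.injective O F))
    (f := (Φ.toAlgHom.restrictScalars A).comp Algebra.TensorProduct.includeRight) hΦ
  exact ⟨Φ, ρ, fun h => (AlgHom.congr_fun hρ h).symm⟩

end Model

/-! ### Schur elements -/

section Schur

variable {A O F : Type*} [CommRing A] [Field F] [Algebra A F] {H : Type*} [Ring H] [Algebra A H]
  {t : H →ₗ[A] A} {ι : Type*} [Finite ι] {n : ι → ℕ} [∀ i, NeZero (n i)]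
  (Φ : F ⊗[A] H ≃ₐ[F] MatrixProd F n)

lemma mul_extendForm_matrixSingle [DecidableEq ι] {i : ι} {s : F}
    (hs : IsSchurElement t (irrEquiv Φ i) s) (E : Matrix (Fin (n i)) (Fin (n i)) F) :
    s * extendForm F t (matrixSingle Φ i E) = E.trace := by
  obtain ⟨z, hz, hact⟩ := hs
  have hzE : z * matrixSingle Φ i E = s • matrixSingle Φ i E := by
    rw [mul_matrixSingle, (actsBy_irrEquiv_iff Φ i z s).1 hact, smul_one_mul, matrixSingle,
      Pi.single_smul, map_smul, matrixSingle]
  rw [← smul_eq_mul, ← map_smul, ← hzE, hz, irrEquiv_apply, apply_matrixSingle, Pi.single_eq_same]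

lemma schurElement_ne_zero {i : ι} {s : F} (hs : IsSchurElement t (irrEquiv Φ i) s) : s ≠ 0 := by
  classical
  rintro rfl
  have h := mul_extendForm_matrixSingle Φ hs (Matrix.single 0 0 1)
  rw [zero_mul, Matrix.trace_single_eq_same] at h
  exact zero_ne_one h

lemma extendForm_eq_sum_trace [Fintype ι] {s : ι → F}
    (hs : ∀ i, IsSchurElement t (irrEquiv Φ i) (s i)) (x : F ⊗[A] H) :
    extendForm F t x = ∑ i, (s i)⁻¹ * (Φ x i).trace := by
  classical
  have hx : x = ∑ i, matrixSingle Φ i (Φ x i) := Φ.injective <| by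
    simp only [map_sum, apply_matrixSingle, Finset.univ_sum_single]
  conv_lhs => rw [hx]
  rw [map_sum]
  refine Finset.sum_congr rfl fun i _ => ?_
  rw [← mul_extendForm_matrixSingle Φ (hs i), inv_mul_cancel_left₀ (schurElement_ne_zero Φ (hs i))]

variable [CommRing O] [Algebra A O] [Algebra O F] [IsScalarTower A O F]

lemma exists_linearMap_eq_extendForm {ρ : H →ₐ[A] MatrixProd O n}
    (hρ : ∀ h, Φ (1 ⊗ₜ[A] h) = MatrixProd.map (IsScalarTower.toAlgHom A O F) (ρ h)) {s : ι → Oˣ}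
    (hs : ∀ i, IsSchurElement t (irrEquiv Φ i) (algebraMap O F (s i))) {T : MatrixProd O n}
    {w : F ⊗[A] H} (hw : Φ w = MatrixProd.map (IsScalarTower.toAlgHom A O F) T) :
    ∃ g : H →ₗ[A] O, ∀ h, algebraMap O F (g h) = extendForm F t (w * 1 ⊗ₜ[A] h) := by
  have := Fintype.ofFinite ι
  refine ⟨∑ i, LinearMap.mulLeft A ((s i)⁻¹ : Oˣ).val ∘ₗ
    Matrix.traceLinearMap (Fin (n i)) A O ∘ₗ LinearMap.proj i ∘ₗ LinearMap.mulLeft A T ∘ₗ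
      ρ.toLinearMap, fun h => ?_⟩
  rw [extendForm_eq_sum_trace Φ hs, map_mul, hw, hρ, ← map_mul, LinearMap.sum_apply, map_sum]
  refine Finset.sum_congr rfl fun i _ => ?_
  have hinv : algebraMap O F ((s i)⁻¹ : Oˣ) = (algebraMap O F (s i))⁻¹ :=
    eq_inv_of_mul_eq_one_left (by rw [← map_mul, Units.inv_mul, map_one])
  rw [← hinv, MatrixProd.map_apply]
  exact (map_mul (algebraMap O F) _ _).trans <| congrArg _ <|
    AddMonoidHom.map_trace (algebraMap O F).toAddMonoidHom ((T * ρ h) i)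

lemma exists_smul_eq_one_tmul_of_extendForm [IsFractionRing A F] [Module.Free A H]
    [Module.Finite A H] (ht : IsSymmetrizing t) (W : Submonoid A) [IsLocalization W O]
    {w : F ⊗[A] H} {g : H →ₗ[A] O}
    (hg : ∀ h, algebraMap O F (g h) = extendForm F t (w * 1 ⊗ₜ[A] h)) :
    ∃ d ∈ W, ∃ h : H, d • w = 1 ⊗ₜ[A] h := by
  have := Module.finitePresentation_of_projective A H
  obtain ⟨l, d, hl⟩ := Module.FinitePresentation.exists_lift_of_isLocalizedModule W
    (Algebra.linearMap A O) g
  obtain ⟨h, rfl⟩ := ht.2.2 l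
  refine ⟨d, d.2, h, ?_⟩
  rw [← sub_eq_zero, ← algebraMap_smul F]
  refine eq_zero_of_extendForm_mul_eq_zero ht fun x => ?_
  have hx : algebraMap A O (t (h * x)) = algebraMap A O d * g x := by
    simpa [Algebra.smul_def, Submonoid.smul_def] using LinearMap.congr_fun hl x
  rw [sub_mul, map_sub, smul_mul_assoc, map_smul, ← hg, Algebra.TensorProduct.tmul_mul_tmul,
    one_mul, extendForm_one_tmul, smul_eq_mul, IsScalarTower.algebraMap_apply A O F d,
    IsScalarTower.algebraMap_apply A O F (t _), hx, map_mul, sub_self]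

lemma exists_eq_smul_of_isSchurElement [IsFractionRing A F] [Module.Free A H]
    [Module.Finite A H] (ht : IsSymmetrizing t) (W : Submonoid A) [IsLocalization W O]
    (hOF : Function.Injective (algebraMap O F)) {ρ : H →ₐ[A] MatrixProd O n}
    (hρ : ∀ h, Φ (1 ⊗ₜ[A] h) = MatrixProd.map (IsScalarTower.toAlgHom A O F) (ρ h)) {s : ι → Oˣ}
    (hs : ∀ i, IsSchurElement t (irrEquiv Φ i) (algebraMap O F (s i))) (T : MatrixProd O n) :
    ∃ d ∈ W, ∃ h : H, ρ h = d • T := by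
  obtain ⟨w, hw⟩ := Φ.surjective (MatrixProd.map (IsScalarTower.toAlgHom A O F) T)
  obtain ⟨g, hg⟩ := exists_linearMap_eq_extendForm Φ hρ hs hw
  obtain ⟨d, hd, h, hdh⟩ := exists_smul_eq_one_tmul_of_extendForm ht W hg
  refine ⟨d, hd, h, MatrixProd.map_injective (g := IsScalarTower.toAlgHom A O F) hOF ?_⟩
  rw [← hρ, ← hdh, map_smul (MatrixProd.map (IsScalarTower.toAlgHom A O F)), ← hw]
  exact map_smul (Φ.toAlgHom.restrictScalars A) d w

end Schur

/-! ### Characteristic polynomials -/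

section Charpoly

open Polynomial

lemma charpoly_dvd_pow_card {R m : Type*} [CommRing R] [Fintype m] [DecidableEq m]
    {T : Matrix m m R} {f : R[X]} (hf : aeval T f = 0) : T.charpoly ∣ f ^ Fintype.card m := by
  -- `X - T` divides `f(X) - f(T) = f(X)`; take determinants
  let ev : R[X][X] →ₐ[R[X]] Matrix m m R[X] := aeval (T.map C)
  have hX : ev (X - C X) = -T.charmatrix := by
    rw [map_sub, aeval_X, aeval_C, Matrix.charmatrix, neg_sub]
    rfl
  have hmap : ev (f.map C) = 0 := by
    have h : aeval (C.mapMatrix T) (f.map C) = C.mapMatrix (aeval T f) := by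
      rw [← algebraMap_eq, aeval_map_algebraMap]
      exact aeval_algHom_apply (Algebra.ofId R R[X]).mapMatrix T f
    rw [hf, map_zero] at h
    exact h
  have hdvd : -T.charmatrix ∣ algebraMap R[X] (Matrix m m R[X]) f := by
    have h := map_dvd ev (X_sub_C_dvd_sub_C_eval (a := (X : R[X])) (p := f.map C))
    rwa [hX, map_sub, hmap, zero_sub, dvd_neg, eval_map, eval₂_C_X, aeval_C] at h
  have hdet := map_dvd Matrix.detMonoidHom (neg_dvd.1 hdvd)
  rwa [Matrix.coe_detMonoidHom, Algebra.algebraMap_eq_smul_one, Matrix.det_smul, Matrix.det_one,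
    mul_one] at hdet

lemma exists_map_eq_charpoly {A O : Type*} (F : Type*) [CommRing A] [IsIntegrallyClosed A]
    [CommRing O] [Field F] [Algebra A O] [Algebra O F] [Algebra A F] [IsScalarTower A O F]
    [IsFractionRing A F] (hOF : Function.Injective (algebraMap O F))
    {m : Type*} [Fintype m] [DecidableEq m] {T : Matrix m m O} (hT : IsIntegral A T) :
    ∃ f : A[X], f.map (algebraMap A O) = T.charpoly := by
  obtain ⟨g, hg, hgT⟩ := hT
  have hdvd : (T.charpoly.map (algebraMap O F)) ∣
      (g ^ Fintype.card m).map (algebraMap A F) := by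
    rw [IsScalarTower.algebraMap_eq A O F, ← map_map]
    refine map_dvd (mapRingHom _) ?_
    rw [Polynomial.map_pow]
    exact charpoly_dvd_pow_card ((aeval_map_algebraMap O T g).trans hgT)
  obtain ⟨f, hf⟩ := IsIntegrallyClosed.eq_map_mul_C_of_dvd F (hg.pow _) hdvd
  refine ⟨f, map_injective _ hOF ?_⟩
  rwa [((Matrix.charpoly_monic T).map _).leadingCoeff, C_1, mul_one,
    IsScalarTower.algebraMap_eq A O F, ← map_map] at hf

end Charpoly

/-! ### The specialized algebra -/

section Specialized

variable {A : Type u} [CommRing A] {B : Type w} [CommRing B] (φ : A →+* B)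
  (H : Type v) [Ring H] [Algebra A H]

variable {H}

lemma specialize_surjective (hφ : Function.Surjective φ) :
    Function.Surjective (specialize φ : H → Specialized φ H) :=
  let _ := φ.toAlgebra
  Algebra.TensorProduct.includeRight_surjective H hφ

instance [Module.Finite A H] : Module.Finite B (Specialized φ H) :=
  let _ := φ.toAlgebra
  inferInstanceAs (Module.Finite B (B ⊗[A] H))

instance [Module.Free A H] : Module.Free B (Specialized φ H) :=
  let _ := φ.toAlgebra
  inferInstanceAs (Module.Free B (B ⊗[A] H))

lemma finrank_specialized [Module.Free A H] [StrongRankCondition A] [StrongRankCondition B] :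
    Module.finrank B (Specialized φ H) = Module.finrank A H :=
  let _ := φ.toAlgebra
  Module.finrank_baseChange (R := B) (S := A) (M' := H)

lemma exists_algHom_specialized {T : Type*} [Ring T] [Algebra B T] (f : H →+* T)
    (hf : ∀ a, f (algebraMap A H a) = algebraMap B T (φ a)) :
    ∃ g : Specialized φ H →ₐ[B] T, ∀ h, g (specialize φ h) = f h := by
  let _ := φ.toAlgebra
  let _ : Algebra A T := Algebra.compHom T φ
  have : IsScalarTower A B T := .of_algebraMap_eq fun _ => rfl
  let f' : H →ₐ[A] T := { f with commutes' := hf }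
  refine ⟨Algebra.TensorProduct.lift (Algebra.ofId B T) f' fun b h => Algebra.commutes b (f' h),
    fun h => ?_⟩
  exact (Algebra.TensorProduct.lift_tmul _ _ _ _ _).trans (by rw [map_one, one_mul]; rfl)

end Specialized

section Reduction

variable {A : Type*} [CommRing A] {B : Type w} [CommRing B] {φ : A →+* B}
  {H : Type v} [Ring H] [Algebra A H] {O L : Type*} [CommRing O] [Algebra A O] [Field L]
  [Algebra A L] [Algebra B L] {ι : Type*} {n : ι → ℕ}

lemma exists_algHom_tensor_specialized (hAL : ∀ a, algebraMap A L a = algebraMap B L (φ a))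
    {T : Type*} [Ring T] [Algebra L T] [Algebra A T] [IsScalarTower A L T] (f : H →ₐ[A] T) :
    ∃ g : L ⊗[B] Specialized φ H →ₐ[L] T, ∀ h, g (1 ⊗ₜ[B] specialize φ h) = f h := by
  let _ : Algebra B T := Algebra.compHom T (algebraMap B L)
  have : IsScalarTower B L T := .of_algebraMap_eq fun _ => rfl
  obtain ⟨g, hg⟩ := exists_algHom_specialized φ (f : H →+* T) fun a => by
    rw [RingHom.coe_coe, AlgHom.commutes, IsScalarTower.algebraMap_apply A L T, hAL]
    rfl
  refine ⟨Algebra.TensorProduct.lift (Algebra.ofId L T) g fun c x => Algebra.commutes c (g x),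
    fun h => ?_⟩
  exact (Algebra.TensorProduct.lift_tmul _ _ _ _ _).trans (by rw [map_one, one_mul, hg]; rfl)

lemma surjective_of_exists_eq_smul {ψ : O →ₐ[A] L} (hψ : Function.Surjective ψ)
    {ρ : H →ₐ[A] MatrixProd O n}
    (hρ : ∀ T, ∃ d, algebraMap A L d ≠ 0 ∧ ∃ h, ρ h = d • T)
    {g : L ⊗[B] Specialized φ H →ₐ[L] MatrixProd L n}
    (hg : ∀ h, g (1 ⊗ₜ[B] specialize φ h) = MatrixProd.map ψ (ρ h)) :
    Function.Surjective g := by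
  intro T'
  obtain ⟨T, rfl⟩ := MatrixProd.map_surjective hψ T'
  obtain ⟨d, hd, h, hT⟩ := hρ T
  refine ⟨(algebraMap A L d)⁻¹ • 1 ⊗ₜ[B] specialize φ h, ?_⟩
  rw [map_smul, hg, hT, map_smul, ← algebraMap_smul L d, inv_smul_smul₀ hd]

lemma exists_algEquiv_specialized [IsDomain A] [IsDomain B] [Module.Free A H] [Module.Finite A H]
    [Finite ι] {F : Type*} [Field F] [Algebra A F] (Φ : F ⊗[A] H ≃ₐ[F] MatrixProd F n)
    (hAL : ∀ a, algebraMap A L a = algebraMap B L (φ a))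
    {ψ : O →ₐ[A] L} (hψ : Function.Surjective ψ) {ρ : H →ₐ[A] MatrixProd O n}
    (hρ : ∀ T, ∃ d, algebraMap A L d ≠ 0 ∧ ∃ h, ρ h = d • T) :
    ∃ Φ' : L ⊗[B] Specialized φ H ≃ₐ[L] MatrixProd L n,
      ∀ h, Φ' (1 ⊗ₜ[B] specialize φ h) = MatrixProd.map ψ (ρ h) := by
  have := Fintype.ofFinite ι
  obtain ⟨g, hg⟩ := exists_algHom_tensor_specialized hAL ((MatrixProd.map ψ).comp ρ)
  have hsurj := surjective_of_exists_eq_smul hψ hρ hg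
  have hrank : Module.finrank L (L ⊗[B] Specialized φ H) =
      Module.finrank L (MatrixProd L n) := by
    have h := Φ.toLinearEquiv.finrank_eq
    rw [Module.finrank_baseChange] at h
    rw [Module.finrank_baseChange, finrank_specialized, h]
    simp only [Module.finrank_pi_fintype, Module.finrank_matrix, Module.finrank_self]
  have hinj : Function.Injective g :=
    (LinearMap.injective_iff_surjective_of_finrank_eq_finrank (f := g.toLinearMap) hrank).2 hsurj
  exact ⟨AlgEquiv.ofBijective g ⟨hinj, hsurj⟩, hg⟩

end Reduction

/-! ### Block-idempotents and sets of components -/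

section BlockIdempotent

variable {S : Type*} [Ring S] {ι : Type*} {M : ι → Type*} [∀ i, Ring (M i)]
  {θ : S →+* Π i, M i} {e : S} {C : Set ι}

lemma isIdempotentElem_of_map_eq_componentIdem (hθ : Function.Injective θ)
    (he : θ e = componentIdem M C) : IsIdempotentElem e :=
  hθ <| by rw [map_mul, he, isIdempotentElem_componentIdem C]

lemma mem_center_of_map_eq_componentIdem (hθ : Function.Injective θ)
    (he : θ e = componentIdem M C) : e ∈ Set.center S :=
  Semigroup.mem_center_iff.2 fun x => hθ <| by
    rw [map_mul, map_mul, he, Semigroup.mem_center_iff.1 (componentIdem_mem_center C)]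

variable [∀ i, Nontrivial (M i)]

lemma IsBlockIdempotent.eq_empty_or_eq (hθ : Function.Injective θ) (he : IsBlockIdempotent e)
    (heC : θ e = componentIdem M C) {D : Set ι} (hDC : D ⊆ C)
    (hD : ∃ f, θ f = componentIdem M D) : D = ∅ ∨ D = C := by
  obtain ⟨f, hf⟩ := hD
  have hg : θ (e - f) = componentIdem M (C \ D) := by rw [map_sub, heC, hf, componentIdem_sdiff hDC]
  have hfg : f * (e - f) = 0 := hθ <| by
    rw [map_mul, hf, hg, componentIdem_mul, Set.inter_sdiff_self, componentIdem_empty, map_zero]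
  refine (he.primitive f (e - f) (mem_center_of_map_eq_componentIdem hθ hf)
    (mem_center_of_map_eq_componentIdem hθ hg) (isIdempotentElem_of_map_eq_componentIdem hθ hf)
    (isIdempotentElem_of_map_eq_componentIdem hθ hg) hfg (add_sub_cancel f e).symm).imp ?_ ?_
  · rintro rfl
    exact componentIdem_injective M (by rw [← hf, map_zero, componentIdem_empty])
  · intro h
    exact componentIdem_injective M (by rw [← hf, ← heC, sub_eq_zero.1 h])

lemma isBlockIdempotent_of_minimal (hθ : Function.Injective θ) (hcentral : ∀ f : S,
      IsIdempotentElem f → f ∈ Set.center S → ∃ D, θ f = componentIdem M D)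
    (heC : θ e = componentIdem M C) (hne : C.Nonempty)
    (hmin : ∀ D ⊆ C, (∃ f, θ f = componentIdem M D) → D = ∅ ∨ D = C) : IsBlockIdempotent e where
  idem := isIdempotentElem_of_map_eq_componentIdem hθ heC
  central := mem_center_of_map_eq_componentIdem hθ heC
  ne_zero := by
    rintro rfl
    exact hne.ne_empty (componentIdem_injective M (by rw [← heC, map_zero, componentIdem_empty]))
  primitive f g hf hg hfi _ hfg hefg := by
    obtain ⟨D, hD⟩ := hcentral f hfi hf
    have hDC : D ⊆ C := by
      have hef : e * f = f := by
        rw [hefg, add_mul, hfi.eq, ← Semigroup.mem_center_iff.1 hg f, hfg, add_zero]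
      refine Set.inter_eq_right.1 (componentIdem_injective M ?_)
      rw [← componentIdem_mul, ← heC, ← hD, ← map_mul, hef]
    rcases hmin D hDC ⟨f, hD⟩ with rfl | rfl
    · exact Or.inl (hθ (by rw [hD, map_zero, componentIdem_empty]))
    · have hfe : f = e := hθ (hD.trans heC.symm)
      exact Or.inr (left_eq_add.1 (hfe.trans hefg))

lemma isBlockIdempotent_iff (hθ : Function.Injective θ) (hcentral : ∀ f : S,
      IsIdempotentElem f → f ∈ Set.center S → ∃ D, θ f = componentIdem M D)
    (heC : θ e = componentIdem M C) :
    IsBlockIdempotent e ↔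
      C.Nonempty ∧ ∀ D ⊆ C, (∃ f, θ f = componentIdem M D) → D = ∅ ∨ D = C := by
  refine ⟨fun he => ⟨Set.nonempty_iff_ne_empty.2 ?_, fun _ => he.eq_empty_or_eq hθ heC⟩,
    fun h => isBlockIdempotent_of_minimal hθ hcentral heC h.1 h.2⟩
  rintro rfl
  exact he.ne_zero (hθ (by rw [heC, map_zero, componentIdem_empty]))

end BlockIdempotent

/-! ### Blocks of localizations -/

section Blocks

variable {O : Type u} [CommRing O] [IsDomain O] {S : Type v} [Ring S] [Algebra O S]
  (P : Ideal O) [P.IsPrime]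

variable (S) in
/-- The map `O_P ⊗ S → F ⊗ S`, where `F` is the field of fractions of `O`. -/
abbrev locMap : Localization.AtPrime P ⊗[O] S →ₐ[O] FracAlgebra O S :=
  Algebra.TensorProduct.map (locToFrac O P) (AlgHom.id O S)

lemma locToFrac_injective : Function.Injective (locToFrac O P) :=
  (IsLocalization.lift_injective_iff _).2 fun x y => by
    rw [(IsLocalization.injective (Localization.AtPrime P)
      P.primeCompl_le_nonZeroDivisors).eq_iff]
    exact (IsFractionRing.injective O (FractionRing O)).eq_iff.symm

lemma locMap_injective [Module.Flat O S] : Function.Injective (locMap S P) :=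
  Module.Flat.rTensor_preserves_injective_linearMap (M := S) (locToFrac O P).toLinearMap
    (locToFrac_injective P)

lemma locMap_mem_center {e : Localization.AtPrime P ⊗[O] S}
    (he : e ∈ Set.center (Localization.AtPrime P ⊗[O] S)) :
    locMap S P e ∈ Set.center (FracAlgebra O S) := by
  rw [Semigroup.mem_center_iff] at he ⊢
  intro z
  obtain ⟨d, hd, h, hz⟩ := exists_smul_eq_one_tmul (nonZeroDivisors O) (FractionRing O) z
  have hd0 : algebraMap O (FractionRing O) d ≠ 0 :=
    IsLocalization.to_map_ne_zero_of_mem_nonZeroDivisors _ le_rfl hd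
  have hloc : locMap S P (1 ⊗ₜ[O] h) = d • z := by
    rw [hz, Algebra.TensorProduct.map_tmul, map_one, AlgHom.id_apply]
  have hcomm := congrArg (locMap S P) (he (1 ⊗ₜ[O] h))
  rw [map_mul, map_mul, hloc, smul_mul_assoc, mul_smul_comm,
    ← algebraMap_smul (FractionRing O) d, ← algebraMap_smul (FractionRing O) d] at hcomm
  exact smul_right_injective _ hd0 hcomm

variable {ι : Type*} {n : ι → ℕ}
  (Φ : FracAlgebra O S ≃ₐ[FractionRing O] MatrixProd (FractionRing O) n)

/-- The set `C` of components belongs to a central idempotent of `O_P S`. -/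
def IsIdempotentSet (C : Set ι) : Prop :=
  ∃ e : Localization.AtPrime P ⊗[O] S, Φ (locMap S P e) = componentIdem _ C

variable {P Φ} {C : Set ι}

lemma IsIdempotentSet.exists_eq_smul (hC : IsIdempotentSet P Φ C) :
    ∃ d ∉ P, ∃ h : S, Φ (1 ⊗ₜ[O] h) = d • componentIdem _ C := by
  obtain ⟨e, he⟩ := hC
  obtain ⟨d, hd, h, hh⟩ := exists_smul_eq_one_tmul P.primeCompl (Localization.AtPrime P) e
  have hloc : (1 : FractionRing O) ⊗ₜ[O] h = locMap S P (1 ⊗ₜ[O] h) := by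
    rw [Algebra.TensorProduct.map_tmul, map_one, AlgHom.id_apply]
  refine ⟨d, hd, h, ?_⟩
  rw [hloc, ← hh, map_smul, ← he]
  exact map_smul (Φ.toAlgHom.restrictScalars O) d _

lemma isIdempotentSet_of_eq_smul {d : O} (hd : d ∉ P) {h : S}
    (hh : Φ (1 ⊗ₜ[O] h) = d • componentIdem _ C) : IsIdempotentSet P Φ C := by
  have hd0 : algebraMap O (FractionRing O) d ≠ 0 :=
    IsLocalization.to_map_ne_zero_of_mem_nonZeroDivisors (M := nonZeroDivisors O) _ le_rfl
      (P.primeCompl_le_nonZeroDivisors hd)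
  let u : Localization.AtPrime P := IsLocalization.mk' (M := P.primeCompl) _ 1 ⟨d, hd⟩
  have hu : locToFrac O P u = (algebraMap O (FractionRing O) d)⁻¹ :=
    eq_inv_of_mul_eq_one_left <| by
      rw [← AlgHom.commutes (locToFrac O P) d, ← map_mul,
        IsLocalization.mk'_spec (M := P.primeCompl) _ (1 : O) ⟨d, hd⟩, map_one, map_one]
  have hloc : locMap S P (u ⊗ₜ[O] h) =
      (algebraMap O (FractionRing O) d)⁻¹ • ((1 : FractionRing O) ⊗ₜ[O] h) := by
    rw [TensorProduct.smul_tmul', smul_eq_mul, mul_one, ← hu]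
    rfl
  refine ⟨u ⊗ₜ[O] h, ?_⟩
  rw [hloc, map_smul, hh, ← algebraMap_smul (FractionRing O) d, inv_smul_smul₀ hd0]

lemma exists_eq_componentIdem {e : Localization.AtPrime P ⊗[O] S} (he : IsIdempotentElem e)
    (hc : e ∈ Set.center (Localization.AtPrime P ⊗[O] S)) :
    ∃ C, Φ (locMap S P e) = componentIdem _ C := by
  refine exists_eq_componentIdem_of_mem_center ((he.map (locMap S P)).map Φ)
    (Semigroup.mem_center_iff.2 fun T => ?_)
  obtain ⟨x, rfl⟩ := Φ.surjective T
  rw [← map_mul, Semigroup.mem_center_iff.1 (locMap_mem_center P hc), map_mul]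

variable [∀ i, NeZero (n i)] [Finite ι]

lemma setOf_actsBy_eq {e : Localization.AtPrime P ⊗[O] S}
    (he : Φ (locMap S P e) = componentIdem _ C) :
    {χ | ActsBy χ (locMap S P e) 1} = irrEquiv Φ '' C := by
  ext χ
  obtain ⟨i, rfl⟩ := (irrEquiv Φ).surjective χ
  rw [Set.mem_ofPred_eq, actsBy_irrEquiv_iff, he, one_smul, (irrEquiv Φ).injective.mem_set_image]
  refine ⟨fun h => ?_, componentIdem_of_mem⟩
  by_contra hi
  exact zero_ne_one ((componentIdem_of_notMem hi).symm.trans h)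

lemma image_mem_blocksAt_iff [Module.Flat O S] :
    irrEquiv Φ '' C ∈ blocksAt O S P ↔ IsIdempotentSet P Φ C ∧ C.Nonempty ∧
      ∀ D ⊆ C, IsIdempotentSet P Φ D → D = ∅ ∨ D = C := by
  let θ : Localization.AtPrime P ⊗[O] S →+* MatrixProd (FractionRing O) n :=
    (Φ : FracAlgebra O S →+* MatrixProd (FractionRing O) n).comp (locMap S P : _ →+* _)
  have hθ : Function.Injective θ := Φ.injective.comp (locMap_injective P)
  have hblock {e : Localization.AtPrime P ⊗[O] S} {D : Set ι}
      (he : Φ (locMap S P e) = componentIdem _ D) :=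
    isBlockIdempotent_iff hθ (fun _ => exists_eq_componentIdem) he
  constructor
  · rintro ⟨e, he, hC⟩
    obtain ⟨D, hD⟩ := exists_eq_componentIdem (Φ := Φ) he.idem he.central
    obtain rfl : C = D := (irrEquiv Φ).injective.image_injective (hC.trans (setOf_actsBy_eq hD))
    exact ⟨⟨e, hD⟩, (hblock hD).1 he⟩
  · rintro ⟨⟨e, he⟩, hC⟩
    exact ⟨e, (hblock he).2 hC, (setOf_actsBy_eq he).symm⟩

end Blocks

/-! ### Lifting idempotents -/

section Lifting

open Polynomial

variable {A : Type*} [CommRing A] {O L : Type*} [CommRing O] [Algebra A O] [CommRing L]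
  [Algebra A L] {ψ : O →ₐ[A] L} {H : Type*} [Ring H] [Algebra A H] {ι : Type*} [Finite ι]
  {n : ι → ℕ} {ρ : H →ₐ[A] MatrixProd O n} {C : Set ι} {h : H} {d : A}

lemma aeval_eq_zero_of_dvd {m : Type*} [Fintype m] [DecidableEq m] {T : Matrix m m O}
    {f p : A[X]} (hf : f.map (algebraMap A O) = T.charpoly) (hp : f ∣ p) : aeval T p = 0 := by
  obtain ⟨q, rfl⟩ := hp
  rw [map_mul, ← aeval_map_algebraMap O, hf, Matrix.aeval_self_charpoly, zero_mul]

lemma map_algebraMap_eq_charpoly {m : Type*} [Fintype m] [DecidableEq m] {T : Matrix m m O}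
    {f : A[X]} (hf : f.map (algebraMap A O) = T.charpoly) (ψ : O →ₐ[A] L) :
    f.map (algebraMap A L) = (T.map ψ).charpoly := by
  rw [← ψ.comp_algebraMap, ← Polynomial.map_map, hf]
  exact (Matrix.charpoly_map T (ψ : O →+* L)).symm

lemma exists_apply_eq_zero_of_map_eq (hρ : ∀ h i, ∃ f : A[X], f.map (algebraMap A O) =
      (ρ h i).charpoly) (hC : MatrixProd.map ψ (ρ h) = d • componentIdem _ C) :
    ∃ (y : H) (k : ℕ), (∀ i ∉ C, ρ y i = 0) ∧
      MatrixProd.map ψ (ρ y) = d ^ k • componentIdem _ C := by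
  classical
  have := Fintype.ofFinite ι
  choose f hf using hρ h
  let p : A[X] := ∏ i with i ∉ C, f i
  let k : ℕ := ∑ i with i ∉ C, n i
  have hp : p.map (algebraMap A L) = X ^ k := by
    rw [Polynomial.map_prod, ← Finset.prod_pow_eq_pow_sum]
    refine Finset.prod_congr rfl fun i hi => ?_
    have hi0 : (ρ h i).map ψ = 0 :=
      (eq_smul_componentIdem_iff.1 hC).2 i (Finset.mem_filter.1 hi).2
    rw [map_algebraMap_eq_charpoly (hf i) ψ, hi0, Matrix.charpoly_zero, Fintype.card_fin]
  refine ⟨aeval h (X * p), k + 1, fun i hi => ?_, ?_⟩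
  · rw [← aeval_algHom_apply, aeval_pi_apply₂]
    exact aeval_eq_zero_of_dvd (hf i) <|
      (Finset.dvd_prod_of_mem f (by simpa using hi)).mul_left X
  · rw [← aeval_algHom_apply, ← aeval_algHom_apply, hC, ← aeval_map_algebraMap L,
      Polynomial.map_mul, map_X, hp, ← pow_succ', map_pow, aeval_X, _root_.smul_pow,
      (isIdempotentElem_componentIdem
        (M := fun i => Matrix (Fin (n i)) (Fin (n i)) L) C).pow_succ_eq k]

lemma exists_eq_smul_componentIdem_of_apply_eq_zero
    (hρ : ∀ h i, ∃ f : A[X], f.map (algebraMap A O) = (ρ h i).charpoly)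
    (hC : MatrixProd.map ψ (ρ h) = d • componentIdem _ C) (hnotMem : ∀ i ∉ C, ρ h i = 0) :
    ∃ (g : H) (c : A) (k : ℕ), algebraMap A L c = algebraMap A L d ^ k ∧
      ρ g = c • componentIdem _ C := by
  classical
  have := Fintype.ofFinite ι
  choose f hf using hρ h
  let p : A[X] := ∏ i with i ∈ C, f i
  let k : ℕ := ∑ i with i ∈ C, n i
  have hp : p.map (algebraMap A L) = (X - Polynomial.C (algebraMap A L d)) ^ k := by
    rw [Polynomial.map_prod, ← Finset.prod_pow_eq_pow_sum]
    refine Finset.prod_congr rfl fun i hi => ?_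
    have hid : (ρ h i).map ψ = d • 1 :=
      (eq_smul_componentIdem_iff.1 hC).1 i (Finset.mem_filter.1 hi).2
    rw [map_algebraMap_eq_charpoly (hf i) ψ, hid, ← algebraMap_smul L d,
      Matrix.smul_one_eq_diagonal, Matrix.charpoly_diagonal, Finset.prod_const, Finset.card_univ,
      Fintype.card_fin]
  have hcoeff : algebraMap A L (p.coeff 0) = (-1) ^ k * algebraMap A L d ^ k := by
    rw [← coeff_map, hp, coeff_zero_eq_eval_zero, eval_pow, eval_sub, eval_X, eval_C, zero_sub,
      neg_pow]
  refine ⟨(-1 : A) ^ k • (algebraMap A H (p.coeff 0) - aeval h p), (-1) ^ k * p.coeff 0, k, ?_, ?_⟩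
  · rw [map_mul, hcoeff, map_pow, map_neg, map_one, ← mul_assoc, ← mul_pow, neg_one_mul, neg_neg,
      one_pow, one_mul]
  · rw [map_smul, mul_smul, map_sub, AlgHom.commutes, ← aeval_algHom_apply]
    congr 1
    refine eq_smul_componentIdem_iff.2 ⟨fun i hi => ?_, fun i hi => ?_⟩
    · rw [Pi.sub_apply, aeval_pi_apply₂, aeval_eq_zero_of_dvd (hf i)
        (Finset.dvd_prod_of_mem f (by simpa using hi)), sub_zero, Pi.algebraMap_apply,
        Algebra.algebraMap_eq_smul_one]
    · rw [Pi.sub_apply, aeval_pi_apply₂, hnotMem i hi, Pi.algebraMap_apply, aeval_def,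
        eval₂_at_zero, sub_self]

lemma exists_eq_smul_componentIdem_of_map_eq
    (hρ : ∀ h i, ∃ f : A[X], f.map (algebraMap A O) = (ρ h i).charpoly)
    (hC : MatrixProd.map ψ (ρ h) = d • componentIdem _ C) :
    ∃ (g : H) (c : A) (k : ℕ), algebraMap A L c = algebraMap A L d ^ k ∧
      ρ g = c • componentIdem _ C := by
  obtain ⟨y, k, hy, hyC⟩ := exists_apply_eq_zero_of_map_eq hρ hC
  obtain ⟨g, c, l, hc, hg⟩ := exists_eq_smul_componentIdem_of_apply_eq_zero hρ hyC hy
  exact ⟨g, c, k * l, by rw [hc, map_pow, pow_mul], hg⟩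

end Lifting

/-! ### Specialization along a surjective morphism -/

section Specialization

variable {A : Type u} [CommRing A] [IsDomain A] {B : Type w} [CommRing B] [IsDomain B] {φ : A →+* B}
  {H : Type v} [Ring H] [Algebra A H] {ι : Type*} {n : ι → ℕ}
  {Φ : FracAlgebra A H ≃ₐ[FractionRing A] MatrixProd (FractionRing A) n}
  {Φ' : FracAlgebra B (Specialized φ H) ≃ₐ[FractionRing B] MatrixProd (FractionRing B) n}

lemma image_mem_blocksAt_iff_of_isIdempotentSet_iff [∀ i, NeZero (n i)] [Finite ι]
    [Module.Free A H] {P : Ideal B} [P.IsPrime]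
    (hC : ∀ D, IsIdempotentSet (P.comap φ) Φ D ↔ IsIdempotentSet P Φ' D)
    (X : Set (Irr (FractionRing A) (FracAlgebra A H))) :
    X ∈ blocksAt A H (P.comap φ) ↔
      (irrEquiv Φ).symm.trans (irrEquiv Φ') '' X ∈ blocksAt B (Specialized φ H) P := by
  obtain ⟨D, rfl⟩ := (irrEquiv Φ).surjective.image_surjective X
  have hD : (irrEquiv Φ).symm.trans (irrEquiv Φ') '' (irrEquiv Φ '' D) = irrEquiv Φ' '' D := by
    simp only [Set.image_image, Equiv.trans_apply, Equiv.symm_apply_apply]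
  simp only [hD, image_mem_blocksAt_iff, hC]

variable {O : Type*} [CommRing O] [Algebra A O] [Algebra O (FractionRing A)]
  [IsScalarTower A O (FractionRing A)] [Algebra A (FractionRing B)] {ρ : H →ₐ[A] MatrixProd O n}
  {ψ : O →ₐ[A] FractionRing B}

lemma isTitsBijection_irrEquiv [∀ i, NeZero (n i)] [Finite ι]
    (hAL : ∀ a, algebraMap A (FractionRing B) a = algebraMap B (FractionRing B) (φ a))
    (hρ : ∀ h, Φ (1 ⊗ₜ[A] h) = MatrixProd.map (IsScalarTower.toAlgHom A O _) (ρ h))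
    (hΦ' : ∀ h, Φ' (1 ⊗ₜ[B] specialize φ h) = MatrixProd.map ψ (ρ h))
    (htrace : ∀ h i, ∃ c : A, algebraMap A O c = (ρ h i).trace) :
    IsTitsBijection φ H ((irrEquiv Φ).symm.trans (irrEquiv Φ')) := by
  intro χ h
  obtain ⟨i, rfl⟩ := (irrEquiv Φ).surjective χ
  obtain ⟨c, hc⟩ := htrace h i
  refine ⟨c, ?_, ?_⟩
  · rw [irrEquiv_apply, hρ, IsScalarTower.algebraMap_apply A O, hc]
    exact (AddMonoidHom.map_trace (algebraMap O (FractionRing A)).toAddMonoidHom _).symm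
  · rw [Equiv.trans_apply, Equiv.symm_apply_apply, irrEquiv_apply, hΦ', ← hAL, ← ψ.commutes, hc]
    exact (AddMonoidHom.map_trace (ψ : O →+* FractionRing B).toAddMonoidHom _).symm

variable {P : Ideal B} [P.IsPrime] {C : Set ι}

lemma IsIdempotentSet.specialized
    (hAL : ∀ a, algebraMap A (FractionRing B) a = algebraMap B (FractionRing B) (φ a))
    (hOF : Function.Injective (algebraMap O (FractionRing A)))
    (hρ : ∀ h, Φ (1 ⊗ₜ[A] h) = MatrixProd.map (IsScalarTower.toAlgHom A O _) (ρ h))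
    (hΦ' : ∀ h, Φ' (1 ⊗ₜ[B] specialize φ h) = MatrixProd.map ψ (ρ h))
    (hC : IsIdempotentSet (P.comap φ) Φ C) : IsIdempotentSet P Φ' C := by
  obtain ⟨d, hd, h, hh⟩ := hC.exists_eq_smul
  have hρh : ρ h = d • componentIdem _ C :=
    MatrixProd.map_injective (g := IsScalarTower.toAlgHom A O (FractionRing A)) hOF <| by
      rw [← hρ, hh, map_smul, MatrixProd.map_componentIdem]
  refine isIdempotentSet_of_eq_smul hd (h := specialize φ h) ?_
  rw [hΦ', hρh, map_smul, MatrixProd.map_componentIdem, ← algebraMap_smul (FractionRing B) d, hAL,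
    algebraMap_smul]

lemma IsIdempotentSet.of_specialized [Finite ι] (hφ : Function.Surjective φ)
    (hAL : ∀ a, algebraMap A (FractionRing B) a = algebraMap B (FractionRing B) (φ a))
    (hρ : ∀ h, Φ (1 ⊗ₜ[A] h) = MatrixProd.map (IsScalarTower.toAlgHom A O _) (ρ h))
    (hΦ' : ∀ h, Φ' (1 ⊗ₜ[B] specialize φ h) = MatrixProd.map ψ (ρ h))
    (hchar : ∀ h i, ∃ f : Polynomial A, f.map (algebraMap A O) = (ρ h i).charpoly)
    (hC : IsIdempotentSet P Φ' C) : IsIdempotentSet (P.comap φ) Φ C := by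
  obtain ⟨d', hd, h', hh⟩ := hC.exists_eq_smul
  obtain ⟨d, rfl⟩ := hφ d'
  obtain ⟨h, rfl⟩ := specialize_surjective φ hφ h'
  rw [hΦ', ← algebraMap_smul (FractionRing B) (φ d), ← hAL, algebraMap_smul] at hh
  obtain ⟨g, c, k, hc, hg⟩ := exists_eq_smul_componentIdem_of_map_eq hchar hh
  have hφc : φ c = φ d ^ k := IsFractionRing.injective B (FractionRing B) <| by
    rw [← hAL, hc, hAL, map_pow]
  refine isIdempotentSet_of_eq_smul (d := c) (h := g) ?_ ?_
  · rw [Ideal.mem_comap, hφc]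
    exact fun hk => hd (‹P.IsPrime›.mem_of_pow_mem k hk)
  · rw [hρ, hg, map_smul, MatrixProd.map_componentIdem]

variable [IsIntegrallyClosed A] [Module.Free A H] [Module.Finite A H] {t : H →ₗ[A] A}

lemma exists_titsBijection_blocksAt_of_isLocalization [IsDomain O] [IsPrincipalIdealRing O]
    [IsFractionRing O (FractionRing A)] (W : Submonoid A) [IsLocalization W O]
    (hφ : Function.Surjective φ) (hW : ∀ d ∈ W, φ d ≠ 0)
    (hAL : ∀ a, algebraMap A (FractionRing B) a = algebraMap B (FractionRing B) (φ a))
    (hψ : Function.Surjective ψ) (ht : IsSymmetrizing t)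
    (hss : IsSplitSemisimple (FractionRing A) (FracAlgebra A H))
    (hschur : ∀ χ, ∃ s : Oˣ, IsSchurElement t χ (algebraMap O (FractionRing A) s))
    (P : Ideal B) [P.IsPrime] :
    IsSplitSemisimple (FractionRing B) (FracAlgebra B (Specialized φ H)) ∧
    ∃ σ : Irr (FractionRing A) (FracAlgebra A H) ≃
        Irr (FractionRing B) (FracAlgebra B (Specialized φ H)),
      IsTitsBijection φ H σ ∧
      ∀ C, C ∈ blocksAt A H (P.comap φ) ↔ σ '' C ∈ blocksAt B (Specialized φ H) P := by
  have hOF := IsFractionRing.injective O (FractionRing A)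
  obtain ⟨_, n, _, ⟨Φ₀⟩⟩ := exists_algEquiv_of_isSplitSemisimple hss
  obtain ⟨Φ, ρ, hρ⟩ := exists_integral_model O Φ₀
  choose s hs using fun i => hschur (irrEquiv Φ i)
  obtain ⟨Φ', hΦ'⟩ := exists_algEquiv_specialized Φ hAL hψ (ρ := ρ) fun T => by
    obtain ⟨d, hd, hT⟩ := exists_eq_smul_of_isSchurElement Φ ht W hOF hρ hs T
    refine ⟨d, ?_, hT⟩
    rw [hAL, map_ne_zero_iff _ (IsFractionRing.injective B (FractionRing B))]
    exact hW d hd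
  have hchar (h i) : ∃ f : Polynomial A, f.map (algebraMap A O) = (ρ h i).charpoly :=
    exists_map_eq_charpoly (FractionRing A) hOF
      ((Algebra.IsIntegral.isIntegral h).map ((Pi.evalAlgHom A _ i).comp ρ))
  have htrace (h i) : ∃ c : A, algebraMap A O c = (ρ h i).trace := by
    obtain ⟨f, hf⟩ := hchar h i
    exact ⟨-f.coeff (n i - 1), by
      rw [Matrix.trace_eq_neg_charpoly_coeff, ← hf, Polynomial.coeff_map, map_neg,
        Fintype.card_fin]⟩
  exact ⟨isSplitSemisimple_of_algEquiv Φ', _, isTitsBijection_irrEquiv hAL hρ hΦ' htrace,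
    image_mem_blocksAt_iff_of_isIdempotentSet_iff fun _ =>
      ⟨.specialized hAL hOF hρ hΦ', .of_specialized hφ hAL hρ hΦ' hchar⟩⟩

end Specialization

section Localization

variable {A : Type u} [CommRing A] [IsDomain A] [IsIntegrallyClosed A] {B : Type w} [CommRing B]
  [IsDomain B] {φ : A →+* B} {H : Type v} [Ring H] [Algebra A H] [Module.Free A H]
  [Module.Finite A H] {t : H →ₗ[A] A}

theorem exists_titsBijection_blocksAt (hφ : Function.Surjective φ) [(RingHom.ker φ).IsPrime]
    [IsPrincipalIdealRing (Localization.AtPrime (RingHom.ker φ))] (ht : IsSymmetrizing t)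
    (hss : IsSplitSemisimple (FractionRing A) (FracAlgebra A H))
    (hschur : ∀ χ, ∃ s : A, IsSchurElement t χ (algebraMap A (FractionRing A) s) ∧ φ s ≠ 0)
    (P : Ideal B) [P.IsPrime] {Q : Ideal A} [Q.IsPrime] (hQ : Q = P.comap φ) :
    IsSplitSemisimple (FractionRing B) (FracAlgebra B (Specialized φ H)) ∧
    ∃ σ : Irr (FractionRing A) (FracAlgebra A H) ≃
        Irr (FractionRing B) (FracAlgebra B (Specialized φ H)),
      IsTitsBijection φ H σ ∧
      ∀ C, C ∈ blocksAt A H Q ↔ σ '' C ∈ blocksAt B (Specialized φ H) P := by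
  subst hQ
  let W := (RingHom.ker φ).primeCompl
  let O := Localization.AtPrime (RingHom.ker φ)
  let _ : Algebra O (FractionRing A) := (locToFrac A (RingHom.ker φ)).toRingHom.toAlgebra
  have : IsScalarTower A O (FractionRing A) :=
    .of_algebraMap_eq fun a => ((locToFrac A (RingHom.ker φ)).commutes a).symm
  have : IsFractionRing O (FractionRing A) :=
    IsFractionRing.isFractionRing_of_isDomain_of_isLocalization W O _
  let _ : Algebra A (FractionRing B) := ((algebraMap B (FractionRing B)).comp φ).toAlgebra
  have hunit (y : W) : IsUnit (algebraMap A (FractionRing B) y) :=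
    isUnit_iff_ne_zero.2 <| (map_ne_zero_iff _ (IsFractionRing.injective B _)).2 y.2
  let ψ : O →ₐ[A] FractionRing B :=
    IsLocalization.liftAlgHom (M := W) (f := Algebra.ofId A (FractionRing B)) hunit
  have hψ : Function.Surjective ψ := by
    intro x
    obtain ⟨b, c, hc, rfl⟩ := IsFractionRing.div_surjective (A := B) x
    obtain ⟨a, rfl⟩ := hφ b
    obtain ⟨d, rfl⟩ := hφ c
    have hd : d ∈ W := nonZeroDivisors.ne_zero hc
    refine ⟨IsLocalization.mk' O a (⟨d, hd⟩ : W), ?_⟩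
    refine (eq_div_iff (hunit ⟨d, hd⟩).ne_zero).2 ?_
    have h := congrArg ψ (IsLocalization.mk'_spec O a (⟨d, hd⟩ : W))
    rwa [map_mul, ψ.commutes, ψ.commutes] at h
  refine exists_titsBijection_blocksAt_of_isLocalization W hφ (fun _ hd => hd) (fun _ => rfl) hψ
    ht hss (fun χ => ?_) P
  obtain ⟨s, hs, hs0⟩ := hschur χ
  exact ⟨(IsLocalization.map_units O (⟨s, hs0⟩ : W)).unit, by
    rwa [IsUnit.unit_spec, ← IsScalarTower.algebraMap_apply]⟩

end Localization

/-! ### Laurent polynomials -/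

section PrincipalLocalization

lemma isPrincipalIdealRing_localization_of_finiteMultiplicity {A : Type*} [CommRing A] [IsDomain A]
    {π : A} (hπ : Prime π) (hfin : ∀ x ≠ 0, FiniteMultiplicity π x) {P : Ideal A} [P.IsPrime]
    (hP : P = Ideal.span {π}) : IsPrincipalIdealRing (Localization.AtPrime P) := by
  let O := Localization.AtPrime P
  have hinj : Function.Injective (algebraMap A O) :=
    IsLocalization.injective O P.primeCompl_le_nonZeroDivisors
  have hπO : Prime (algebraMap A O π) := by
    rw [← Ideal.span_singleton_prime ((map_ne_zero_iff _ hinj).2 hπ.ne_zero),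
      ← Set.image_singleton, ← Ideal.map_span, ← hP, Localization.AtPrime.map_eq_maximalIdeal]
    exact (IsLocalRing.maximalIdeal.isMaximal O).isPrime
  have hO : IsDiscreteValuationRing.HasUnitMulPowIrreducibleFactorization O := by
    refine ⟨_, hπO.irreducible, fun {x} hx => ?_⟩
    obtain ⟨b, s, rfl⟩ := IsLocalization.exists_mk'_eq P.primeCompl x
    have hb : b ≠ 0 := fun h => hx (by rw [h, IsLocalization.mk'_zero])
    obtain ⟨c, hbc, hc⟩ := (hfin b hb).exists_eq_pow_mul_and_not_dvd
    have hcP : c ∈ P.primeCompl := fun h => hc (Ideal.mem_span_singleton.1 (hP ▸ h))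
    have hbs := associated_mul_unit_right (IsLocalization.mk' O b s) _
      (IsLocalization.map_units O s)
    rw [IsLocalization.mk'_spec] at hbs
    have hbπ := associated_mul_unit_right (algebraMap A O π ^ multiplicity π b) _
      (IsLocalization.map_units O (⟨c, hcP⟩ : P.primeCompl))
    rw [← map_pow, ← map_mul, ← hbc, map_pow] at hbπ
    exact ⟨_, hbπ.trans hbs.symm⟩
  have := IsDiscreteValuationRing.ofHasUnitMulPowIrreducibleFactorization hO
  infer_instance

end PrincipalLocalization

section LaurentRing

variable {R : Type u} [CommRing R]

variable (R) in
/-- Splitting off the first indeterminate. -/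
def laurentSuccEquiv (k : ℕ) : Laurent R (k + 1) ≃+* LaurentPolynomial (Laurent R k) :=
  (AddMonoidAlgebra.mapDomainRingEquiv R
    (Fin.consLinearEquiv ℤ fun _ : Fin (k + 1) => ℤ).symm.toAddEquiv).trans
    AddMonoidAlgebra.curryRingEquiv

instance isIntegrallyClosed_laurent [IsDomain R] [IsIntegrallyClosed R] :
    ∀ k : ℕ, IsIntegrallyClosed (Laurent R k)
  | 0 => IsIntegrallyClosed.of_equiv (AddMonoidAlgebra.uniqueRingEquiv (R := R) (Fin 0 → ℤ)).symm
  | k + 1 => by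
    have := isIntegrallyClosed_laurent k
    have : IsIntegrallyClosed (LaurentPolynomial (Laurent R k)) :=
      isIntegrallyClosed_of_isLocalization (R := Polynomial (Laurent R k)) _
        (Submonoid.powers Polynomial.X)
        (Submonoid.powers_le.2 (mem_nonZeroDivisors_of_ne_zero Polynomial.X_ne_zero))
    exact IsIntegrallyClosed.of_equiv (laurentSuccEquiv R k).symm

lemma monomial_zero {k : ℕ} : monomial R (0 : Fin k → ℤ) = 1 := rfl

lemma smul_monomial {k : ℕ} (r : R) (l : Fin k → ℤ) :
    r • monomial R l = AddMonoidAlgebra.single l r := by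
  rw [monomial, AddMonoidAlgebra.smul_single, smul_eq_mul, mul_one]

lemma ker_mapRingHom_laurent (p : Ideal R) (k : ℕ) :
    RingHom.ker (AddMonoidAlgebra.mapRingHom (Fin k → ℤ) (Ideal.Quotient.mk p)) =
      p.map (algebraMap R (Laurent R k)) := by
  refine le_antisymm (fun x hx => ?_) (Ideal.map_le_iff_le_comap.2 fun r hr => ?_)
  · have hcoeff (l : Fin k → ℤ) : x.coeff l ∈ p := by
      rw [← Ideal.Quotient.eq_zero_iff_mem, ← AddMonoidAlgebra.coeff_mapRingHom,
        RingHom.mem_ker.1 hx, AddMonoidAlgebra.coeff_zero, Finsupp.zero_apply]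
    rw [← AddMonoidAlgebra.sum_coeff_single x]
    refine Ideal.sum_mem _ fun l _ => ?_
    rw [← smul_monomial, Algebra.smul_def]
    exact Ideal.mul_mem_right _ _ (Ideal.mem_map_of_mem _ (hcoeff l))
  · rw [Ideal.mem_comap, RingHom.mem_ker, Algebra.algebraMap_eq_smul_one, ← monomial_zero,
      smul_monomial, AddMonoidAlgebra.mapRingHom_single, Ideal.Quotient.eq_zero_iff_mem.2 hr,
      AddMonoidAlgebra.single_zero]

lemma isPrime_map_algebraMap_laurent (p : Ideal R) [p.IsPrime] (k : ℕ) :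
    (p.map (algebraMap R (Laurent R k))).IsPrime :=
  ker_mapRingHom_laurent p k ▸ RingHom.ker_isPrime _

lemma monomial_add {k : ℕ} (b c : Fin k → ℤ) :
    monomial R (b + c) = monomial R b * monomial R c := by
  rw [monomial, monomial, monomial, AddMonoidAlgebra.single_mul_single, one_mul]

lemma monomial_injective [Nontrivial R] (k : ℕ) :
    Function.Injective (monomial R : (Fin k → ℤ) → Laurent R k) :=
  AddMonoidAlgebra.of_injective

lemma monomial_ne_zero [Nontrivial R] {k : ℕ} (b : Fin k → ℤ) : monomial R b ≠ 0 :=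
  AddMonoidAlgebra.single_ne_zero.2 one_ne_zero

lemma mk_monomial_eq_mk_monomial {k : ℕ} {a b c : Fin k → ℤ}
    (h : b - c ∈ AddSubgroup.zmultiples a) :
    Ideal.Quotient.mk (Ideal.span {monomial R a - 1}) (monomial R b) =
      Ideal.Quotient.mk (Ideal.span {monomial R a - 1}) (monomial R c) := by
  obtain ⟨z, hz⟩ := AddSubgroup.mem_zmultiples_iff.1 h
  let g := (Ideal.Quotient.mk (Ideal.span {monomial R a - 1})).toMonoidHom.comp
    (AddMonoidAlgebra.of R (Fin k → ℤ))
  have ha : Multiplicative.ofAdd a ∈ g.ker :=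
    Ideal.Quotient.eq.2 (Ideal.mem_span_singleton_self _)
  have hza : Ideal.Quotient.mk (Ideal.span {monomial R a - 1}) (monomial R (z • a)) = 1 :=
    g.ker.zpow_mem ha z
  rw [← sub_add_cancel b c, ← hz, monomial_add, map_mul, hza, one_mul]

lemma not_isUnit_monomial_sub_one [Nontrivial R] {k : ℕ} (a : Fin k → ℤ) :
    ¬IsUnit (monomial R a - 1) := by
  intro h
  let ε : Laurent R k →ₐ[R] R := AddMonoidAlgebra.lift R R (Fin k → ℤ) 1
  have hε : ε (monomial R a - 1) = 0 := by
    rw [map_sub, map_one, monomial, AddMonoidAlgebra.lift_single, MonoidHom.one_apply, one_smul,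
      sub_self]
  exact not_isUnit_zero (hε ▸ h.map ε)

lemma finiteMultiplicity_monomial_sub_one [IsDomain R] {k : ℕ} (a : Fin k → ℤ) {x : Laurent R k}
    (hx : x ≠ 0) : FiniteMultiplicity (monomial R a - 1) x := by
  let K := FractionRing R
  have : AddMonoid.FG (Fin k → ℤ) := AddGroup.fg_iff_addMonoid_fg.1 inferInstance
  have : IsNoetherianRing (Laurent K k) := Algebra.FiniteType.isNoetherianRing K (Laurent K k)
  let g : Laurent R k →+* Laurent K k := AddMonoidAlgebra.mapRingHom _ (algebraMap R K)
  have hg : Function.Injective g :=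
    AddMonoidAlgebra.map_injective (algebraMap R K).toAddMonoidHom (IsFractionRing.injective R K)
  have hga : g (monomial R a - 1) = monomial K a - 1 := by
    rw [map_sub, map_one, monomial, AddMonoidAlgebra.mapRingHom_single, map_one, monomial]
  obtain ⟨j, hj⟩ := FiniteMultiplicity.of_not_isUnit (not_isUnit_monomial_sub_one (R := K) a)
    ((map_ne_zero_iff g hg).2 hx)
  refine ⟨j, fun h => hj ?_⟩
  rw [← hga, ← map_pow]
  exact map_dvd g h

lemma aeval_monomial_ne_zero {k : ℕ} {b : Fin k → ℤ} (hb : b ≠ 0) {f : Polynomial R} (hf : f ≠ 0) :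
    Polynomial.aeval (monomial R b) f ≠ 0 := by
  have hinj : Function.Injective fun i : ℕ => i • b := fun i j hij =>
    Nat.cast_injective (R := ℤ) (smul_left_injective ℤ hb (by simpa only [natCast_zsmul] using hij))
  have haeval : (Polynomial.aeval (monomial R b) f).coeff (f.natDegree • b) = f.leadingCoeff := by
    have hsum : Polynomial.aeval (monomial R b) f =
        ∑ i ∈ Finset.range (f.natDegree + 1), AddMonoidAlgebra.single (i • b) (f.coeff i) := by
      rw [Polynomial.aeval_eq_sum_range]
      exact Finset.sum_congr rfl fun i _ => by
        rw [monomial, AddMonoidAlgebra.single_pow, one_pow, ← monomial, smul_monomial]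
    rw [hsum, AddMonoidAlgebra.coeff_sum, Finsupp.finsetSum_apply,
      Finset.sum_eq_single_of_mem f.natDegree (Finset.self_mem_range_succ _)]
    · rw [AddMonoidAlgebra.coeff_single, Finsupp.single_eq_same, Polynomial.leadingCoeff]
    · intro i _ hi
      rw [AddMonoidAlgebra.coeff_single, Finsupp.single_eq_of_ne (hinj.ne hi.symm)]
  intro h
  rw [h] at haeval
  exact hf (Polynomial.leadingCoeff_eq_zero.1 haeval.symm)

lemma laurent_induction {k : ℕ} {motive : Laurent R k → Prop} (x : Laurent R k)
    (zero : motive 0) (add : ∀ x y, motive x → motive y → motive (x + y))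
    (smul_monomial : ∀ (r : R) l, motive (r • monomial R l)) : motive x := by
  induction x using AddMonoidAlgebra.induction_linear with
  | zero => exact zero
  | add x y hx hy => exact add x y hx hy
  | single l r => exact EssentialBlocks.smul_monomial r l ▸ smul_monomial r l

end LaurentRing

/-! ### Morphisms associated with a monomial -/

section Associated

variable {R : Type u} [CommRing R] {m : ℕ} {a : Fin (m + 1) → ℤ}
  {φ : Laurent R (m + 1) →ₐ[R] Laurent R m}

lemma IsAssociatedWith.surjective (hφ : IsAssociatedWith a φ) : Function.Surjective φ := by
  obtain ⟨f, hf, -, hφf⟩ := hφ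
  intro y
  induction y using laurent_induction with
  | zero => exact ⟨0, map_zero _⟩
  | add x y hx hy =>
    obtain ⟨x, rfl⟩ := hx
    obtain ⟨y, rfl⟩ := hy
    exact ⟨x + y, map_add _ _ _⟩
  | smul_monomial r l =>
    obtain ⟨l, rfl⟩ := hf l
    exact ⟨r • monomial R l, by rw [map_smul, hφf]⟩

lemma IsAssociatedWith.map_monomial_self (hφ : IsAssociatedWith a φ) : φ (monomial R a) = 1 := by
  obtain ⟨f, -, hker, hφf⟩ := hφ
  have ha : a ∈ f.ker := hker ▸ AddSubgroup.mem_zmultiples a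
  rw [hφf, AddMonoidHom.mem_ker.1 ha, monomial_zero]

lemma IsAssociatedWith.ker_eq (hφ : IsAssociatedWith a φ) :
    RingHom.ker φ.toRingHom = Ideal.span {monomial R a - 1} := by
  let I := Ideal.span {monomial R a - 1}
  refine le_antisymm (fun x (hx : φ x = 0) => ?_) ?_
  · obtain ⟨f, hf, hker, hφf⟩ := hφ
    obtain ⟨s, hs⟩ := hf.hasRightInverse
    -- `monomial R l` modulo `I` depends only on `f l`, so the quotient map factors through `φ`
    let τ : Laurent R m →ₗ[R] Laurent R (m + 1) ⧸ I :=
      Finsupp.linearCombination R (fun b => Ideal.Quotient.mk I (monomial R (s b))) ∘ₗ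
        (AddMonoidAlgebra.coeffLinearEquiv R).toLinearMap
    have hτ (b : Fin m → ℤ) : τ (monomial R b) = Ideal.Quotient.mk I (monomial R (s b)) := by
      simp [τ, monomial]
    have hτφ (y : Laurent R (m + 1)) : τ (φ y) = Ideal.Quotient.mkₐ R I y := by
      induction y using laurent_induction with
      | zero => simp
      | add y z hy hz => rw [map_add, map_add, map_add, hy, hz]
      | smul_monomial r l =>
        have hl : s (f l) - l ∈ AddSubgroup.zmultiples a := by
          rw [← hker, AddMonoidHom.mem_ker, map_sub, hs, sub_self]
        rw [map_smul, map_smul, map_smul, hφf, hτ, mk_monomial_eq_mk_monomial hl,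
          Ideal.Quotient.mkₐ_eq_mk]
    rw [← Ideal.Quotient.eq_zero_iff_mem, ← Ideal.Quotient.mkₐ_eq_mk R, ← hτφ, hx, map_zero]
  · rw [Ideal.span_singleton_le_iff_mem]
    change φ (monomial R a - 1) = 0
    rw [map_sub, hφ.map_monomial_self, map_one, sub_self]

lemma IsAssociatedWith.ne_zero (hφ : IsAssociatedWith a φ) : a ≠ 0 := by
  rintro rfl
  obtain ⟨f, -, hker, -⟩ := hφ
  have hf : Function.Injective f.toIntLinearMap := by
    rwa [AddSubgroup.zmultiples_zero_eq_bot, AddMonoidHom.ker_eq_bot_iff] at hker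
  have h := LinearMap.finrank_le_finrank_of_injective hf
  rw [Module.finrank_fin_fun, Module.finrank_fin_fun] at h
  exact Nat.not_succ_le_self m h

lemma IsAssociatedWith.prime_monomial_sub_one [IsDomain R] (hφ : IsAssociatedWith a φ) :
    Prime (monomial R a - 1) := by
  have ha : monomial R a - 1 ≠ 0 :=
    sub_ne_zero.2 ((monomial_injective (R := R) (m + 1)).ne hφ.ne_zero)
  rw [← Ideal.span_singleton_prime ha, ← hφ.ker_eq]
  exact RingHom.ker_isPrime _

lemma IsAssociatedWith.isPrincipalIdealRing_localization_ker [IsDomain R]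
    (hφ : IsAssociatedWith a φ) [(RingHom.ker φ.toRingHom).IsPrime] :
    IsPrincipalIdealRing (Localization.AtPrime (RingHom.ker φ.toRingHom)) :=
  isPrincipalIdealRing_localization_of_finiteMultiplicity hφ.prime_monomial_sub_one
    (fun _ => finiteMultiplicity_monomial_sub_one a) hφ.ker_eq

lemma IsAssociatedWith.idealQ_eq_comap (hφ : IsAssociatedWith a φ) (p : Ideal R) :
    idealQ R p a = (p.map (algebraMap R (Laurent R m))).comap φ.toRingHom := by
  have hmap : p.map (algebraMap R (Laurent R m)) =
      (p.map (algebraMap R (Laurent R (m + 1)))).map φ.toRingHom := by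
    rw [Ideal.map_map]
    exact congrArg p.map φ.comp_algebraMap.symm
  rw [hmap, Ideal.comap_map_of_surjective' φ.toRingHom hφ.surjective, hφ.ker_eq, idealQ]

lemma IsAssociatedWith.map_aeval_monomial_ne_zero [IsDomain R] (hφ : IsAssociatedWith a φ)
    {Ψ : Polynomial R} (hΨ : Ψ ≠ 0)
    (hcop : IsCoprime (Ψ.map (algebraMap R (FractionRing R))) (Polynomial.X - 1))
    (l : Fin (m + 1) → ℤ) : φ (Polynomial.aeval (monomial R l) Ψ) ≠ 0 := by
  obtain ⟨f, -, -, hφf⟩ := hφ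
  rw [← Polynomial.aeval_algHom_apply, hφf]
  by_cases hl : f l = 0
  · have hone : Ψ.eval 1 ≠ 0 := by
      have h := hcop.map (Polynomial.evalRingHom 1)
      rw [map_sub, map_one, Polynomial.coe_evalRingHom, Polynomial.eval_X, sub_self,
        isCoprime_zero_right, Polynomial.eval_one_map] at h
      exact fun h0 => not_isUnit_zero (map_zero (algebraMap R (FractionRing R)) ▸ h0 ▸ h)
    rwa [hl, monomial_zero, ← map_one (algebraMap R (Laurent R m)),
      Polynomial.aeval_algebraMap_apply, Polynomial.coe_aeval_eq_eval,
      map_ne_zero_iff _ (FaithfulSMul.algebraMap_injective R (Laurent R m))]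
  · exact aeval_monomial_ne_zero hl hΨ

end Associated

section Essential

lemma IsSchurElement.ne_zero {A : Type u} [CommRing A] {F : Type w} [Field F] [Algebra A F]
    {H : Type v} [Ring H] [Algebra A H] {t : H →ₗ[A] A} {χ : Irr F (F ⊗[A] H)} {s : F}
    (hs : IsSchurElement t χ s) (hss : IsSplitSemisimple F (F ⊗[A] H)) : s ≠ 0 := by
  obtain ⟨_, n, _, ⟨Φ⟩⟩ := exists_algEquiv_of_isSplitSemisimple hss
  obtain ⟨i, rfl⟩ := (irrEquiv Φ).surjective χ
  exact schurElement_ne_zero Φ hs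

variable {R : Type u} [CommRing R] [IsDomain R] {m : ℕ} {H : Type v} [Ring H]
  [Algebra (Laurent R (m + 1)) H] {t : H →ₗ[Laurent R (m + 1)] Laurent R (m + 1)}
  {a : Fin (m + 1) → ℤ} {φ : Laurent R (m + 1) →ₐ[R] Laurent R m}

lemma IsEssential.exists_isSchurElement_map_ne_zero (hess : IsEssential t)
    (hss : IsSplitSemisimple (FractionRing (Laurent R (m + 1)))
      (FracAlgebra (Laurent R (m + 1)) H))
    (hφ : IsAssociatedWith a φ)
    (χ : Irr (FractionRing (Laurent R (m + 1))) (FracAlgebra (Laurent R (m + 1)) H)) :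
    ∃ s, IsSchurElement t χ (algebraMap (Laurent R (m + 1)) _ s) ∧ φ s ≠ 0 := by
  obtain ⟨ξ, N, k, Ψ, M, r, -, hΨ, -, -, hs⟩ := hess χ
  have hξ : ξ ≠ 0 := by
    rintro rfl
    exact hs.ne_zero hss (by rw [map_zero, zero_mul, zero_mul, map_zero])
  have hN : φ (monomial R N) ≠ 0 := by
    obtain ⟨f, -, -, hφf⟩ := hφ
    exact hφf N ▸ monomial_ne_zero _
  refine ⟨_, hs, ?_⟩
  rw [map_mul, map_mul, AlgHom.commutes, map_prod]
  refine mul_ne_zero (mul_ne_zero ?_ hN) (Finset.prod_ne_zero_iff.2 fun i _ => ?_)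
  · exact (map_ne_zero_iff _ (FaithfulSMul.algebraMap_injective R (Laurent R m))).2 hξ
  · obtain ⟨hmonic, -, -, -, hcop, -⟩ := hΨ i
    rw [map_pow]
    exact pow_ne_zero _ (hφ.map_aeval_monomial_ne_zero hmonic.ne_zero hcop (M i))

end Essential

end EssentialBlocks

end

theorem mainTheorem2_general {R : Type*} [CommRing R] [IsDomain R] [IsIntegrallyClosed R] {m : ℕ}
    {H : Type*} [Ring H] [Algebra (Laurent R (m + 1)) H]
    [Module.Free (Laurent R (m + 1)) H] [Module.Finite (Laurent R (m + 1)) H]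
    {t : H →ₗ[Laurent R (m + 1)] Laurent R (m + 1)}
    (ht : IsSymmetrizing t)
    (hss : IsSplitSemisimple (FractionRing (Laurent R (m + 1)))
      (FracAlgebra (Laurent R (m + 1)) H))
    {a : Fin (m + 1) → ℤ} {φ : Laurent R (m + 1) →ₐ[R] Laurent R m}
    (hφ : IsAssociatedWith a φ)
    (hschur : ∀ χ, ∃ s, IsSchurElement t χ
      (algebraMap (Laurent R (m + 1)) (FractionRing (Laurent R (m + 1))) s) ∧ φ s ≠ 0)
    (p : Ideal R) [p.IsPrime] :
    IsSplitSemisimple (FractionRing (Laurent R m))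
      (FracAlgebra (Laurent R m) (Specialized φ.toRingHom H)) ∧
    ∃ (_ : (idealQ R p a).IsPrime)
      (_ : (p.map (algebraMap R (Laurent R m))).IsPrime)
      (σ : Irr (FractionRing (Laurent R (m + 1))) (FracAlgebra (Laurent R (m + 1)) H) ≃
        Irr (FractionRing (Laurent R m))
          (FracAlgebra (Laurent R m) (Specialized φ.toRingHom H))),
      IsTitsBijection φ.toRingHom H σ ∧
      ∀ C, C ∈ blocksAt (Laurent R (m + 1)) H (idealQ R p a) ↔
        σ '' C ∈ blocksAt (Laurent R m) (Specialized φ.toRingHom H)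
          (p.map (algebraMap R (Laurent R m))) := by
  have hP := isPrime_map_algebraMap_laurent p m
  have hQ : (idealQ R p a).IsPrime := hφ.idealQ_eq_comap p ▸ Ideal.comap_isPrime _ _
  have hker : (RingHom.ker φ.toRingHom).IsPrime := RingHom.ker_isPrime _
  have := hφ.isPrincipalIdealRing_localization_ker
  obtain ⟨hsplit, hσ⟩ := exists_titsBijection_blocksAt hφ.surjective ht hss hschur
    (p.map (algebraMap R (Laurent R m))) (hφ.idealQ_eq_comap p)
  exact ⟨hsplit, hQ, hP, hσ⟩

theorem mainTheorem2 {R : Type*} [CommRing R] [IsDomain R] [IsNoetherianRing R]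
    [IsIntegrallyClosed R] (m : ℕ)
    {H : Type*} [Ring H] [Algebra (Laurent R (m + 1)) H]
    [Module.Free (Laurent R (m + 1)) H] [Module.Finite (Laurent R (m + 1)) H]
    (t : H →ₗ[Laurent R (m + 1)] Laurent R (m + 1))
    (ht : IsSymmetrizing t)
    (hss : IsSplitSemisimple (FractionRing (Laurent R (m + 1)))
      (FracAlgebra (Laurent R (m + 1)) H))
    (hess : IsEssential t)
    (a : Fin (m + 1) → ℤ) (ha : Finset.univ.gcd a = 1)
    (φ : Laurent R (m + 1) →ₐ[R] Laurent R m)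
    (hφ : IsAssociatedWith a φ)
    (p : Ideal R) [p.IsPrime] :
    IsSplitSemisimple (FractionRing (Laurent R m))
      (FracAlgebra (Laurent R m) (Specialized φ.toRingHom H)) ∧
    ∃ (_ : (idealQ R p a).IsPrime)
      (_ : (p.map (algebraMap R (Laurent R m))).IsPrime)
      (σ : Irr (FractionRing (Laurent R (m + 1))) (FracAlgebra (Laurent R (m + 1)) H) ≃
        Irr (FractionRing (Laurent R m))
          (FracAlgebra (Laurent R m) (Specialized φ.toRingHom H))),
      IsTitsBijection φ.toRingHom H σ ∧
      ∀ C, C ∈ blocksAt (Laurent R (m + 1)) H (idealQ R p a) ↔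
        σ '' C ∈ blocksAt (Laurent R m) (Specialized φ.toRingHom H)
          (p.map (algebraMap R (Laurent R m))) :=
  mainTheorem2_general ht hss hφ (hess.exists_isSchurElement_map_ne_zero hss hφ) p
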